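/- **Setting.** Let $n\ge 1$, let $\mathcal A$ be a non-empty collection of subsets (actions) of $[n]$, and $m=\max_{A\in\mathcal A}|A|$. Let $\mathbf X_1,\mathbf X_2,\dots\in\mathbb R^n$ be i.i.d. with law $\mathbb P_{\mathbf X}$ and mean $\boldsymbol\mu^*$. In round $t\ge1$ the agent plays $A_t$ on the basis of the past (and possibly internal randomization), receives $\sum_{i\in A_t}X_{i,t}$, and observes $X_{i,t}$ for $i\in A_t$. Write $\mathbf e_A=\sum_{i\in A}\mathbf e_i$. Let $A^*\in\operatorname{argmax}_{A\in\mathcal A}\mathbf e_A^{\mathsf T}\boldsymbol\mu^*$, $\Delta(A)=(\mathbf e_{A^*}-\mathbf e_A)^{\mathsf T}\boldsymbol\mu^*$, $\Delta=\min_{A\in\mathcal A,\,\Delta(A)>0}\Delta(A)$ and $\Delta_{\max}=\max_{A\in\mathcal A,\,\Delta(A)>0}\Delta(A)$ (some action of $\mathcal A$ is assumed to be suboptimal). The regret is $R_T=\mathbb E\big[\sum_{t=1}^T(\mathbf e_{A^*}-\mathbf e_{A_t})^{\mathsf T}\mathbf X_t\big]$. Put $\nu^*_i=\mathbb E|X_i|$,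 $s\wedge m=\min(s,m)$, $a\vee b=\max(a,b)$. **Algorithm (sparse variant of ESCB-C, with parameter $s$).** Let $N_{i,t}$ be the number of rounds $u\le t$ with $i\in A_u$, and let $\bar\mu_{i,t}$ and $\bar\nu_{i,t}$ be the averages of $X_{i,u}$ and of $|X_{i,u}|$ over these rounds. Initialization: in at most $n$ rounds, play actions of $\mathcal A$, or the full set $[n]$, such that every arm is sampled at least once. In every later round $t$, let $\nu_{i,t}=\bar\nu_{i,t-1}+\sqrt{1.5\log(t)/N_{i,t-1}}$ and $$\mathcal C_t=\bar{\boldsymbol\mu}_{t-1}+\Big\{\boldsymbol\xi\in\mathbb R^n:\ \sum_{i\in[n]}\frac{N_{i,t-1}\,\xi_i^2}{m|\xi_i|+2(s\wedge m)\nu_{i,t}}\le 8(\log t+\log\log t)+4em\Big\},$$ and play $A_t$, where $(A_t,\boldsymbol\mu_t)\in\operatorname{argmax}_{A\in\mathcal A,\ \boldsymbol\mu\in\mathcal C_t}\mathbf e_A^{\mathsf T}\boldsymbol\mu$ (ties broken arbitrarily). **Statement.** For every constant $c>0$ there is a constant $c'>0$, depending only on $c$, such that the following holds. Assume that $\mathbb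 P_{\mathbf X}$ satisfies $\|\mathbf X\|_\infty\le1$ and $\|\mathbf X\|_1\le s$ almost surely, and that $\Delta$ is small enough in the sense that $$\big(\Delta(s\wedge m)\big)^{2/3}\vee\Big(m\Delta+m\Delta\log\frac{\Delta_{\max}}{\Delta}\Big)\le c\,\log(m+1)\sum_{i\in[n]}\frac{\nu_i^*(s\wedge m)}{n}.$$ Then the regret of the algorithm above satisfies $$\limsup_{T\to\infty}\frac{\Delta}{\log T}R_T\ \le\ c'\log^2(m+1)\sum_{i\in[n]}\nu^*_i(s\wedge m)\ \le\ c'\log^2(m+1)\,(s\wedge m)\,s .$$ -/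

import Mathlib

open MeasureTheory ProbabilityTheory Filter

noncomputable section

namespace SemiBandit

/-- The linear functional `e_Aᵀ x`, i.e. the sum of the coordinates of `x` over the action `A`. -/
def total {n : ℕ} (A : Finset (Fin n)) (x : Fin n → ℝ) : ℝ := ∑ i ∈ A, x i

/-- The mean vector `μ* = E[X]` of an outcome distribution `P` on `ℝⁿ`. -/
def meanVec {n : ℕ} (P : Measure (Fin n → ℝ)) (i : Fin n) : ℝ := ∫ x, x i ∂P

/-- The absolute first moments `ν*_i = E|X_i|`. -/
def absMean {n : ℕ} (P : Measure (Fin n → ℝ)) (i : Fin n) : ℝ := ∫ x, |x i| ∂P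

/-- The maximal number of arms `m = max {|A| : A ∈ 𝒜}` of an action. -/
def maxSize {n : ℕ} (𝒜 : Finset (Finset (Fin n))) : ℕ := 𝒜.sup Finset.card

/-- `Astar` is an optimal action: it belongs to `argmax_{A ∈ 𝒜} e_Aᵀ μ*`. -/
def IsOptimal {n : ℕ} (P : Measure (Fin n → ℝ)) (𝒜 : Finset (Finset (Fin n)))
    (Astar : Finset (Fin n)) : Prop :=
  Astar ∈ 𝒜 ∧ ∀ A ∈ 𝒜, total A (meanVec P) ≤ total Astar (meanVec P)

/-- The gap `Δ(A) = (e_{A*} - e_A)ᵀ μ*`. -/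
def gap {n : ℕ} (P : Measure (Fin n → ℝ)) (Astar A : Finset (Fin n)) : ℝ :=
  total Astar (meanVec P) - total A (meanVec P)

/-- The set of positive gaps `{Δ(A) : A ∈ 𝒜, Δ(A) > 0}`. -/
def posGaps {n : ℕ} (P : Measure (Fin n → ℝ)) (𝒜 : Finset (Finset (Fin n)))
    (Astar : Finset (Fin n)) : Set ℝ :=
  {d | 0 < d ∧ ∃ A ∈ 𝒜, gap P Astar A = d}

/-- The stochastic interaction, rounds being numbered `1, 2, …`. The filtration `ℱ` is everything
known (including internal randomization of the agent, e.g. for breaking ties): the outcome `X t` of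
round `t` has law `P`, is revealed at time `t` and is independent of `ℱ (t - 1)`, so that the
outcomes are i.i.d. with law `P`; the action `A t` is chosen on the basis of `ℱ (t - 1)`. -/
structure IsInteraction {n : ℕ} {Ω : Type*} [mΩ : MeasurableSpace Ω] (P : Measure (Fin n → ℝ))
    (Q : Measure Ω) (ℱ : Filtration ℕ mΩ) (X : ℕ → Ω → Fin n → ℝ)
    (A : ℕ → Ω → Finset (Fin n)) : Prop where
  outcome_measurable : ∀ t, 1 ≤ t → Measurable[ℱ t] (X t)
  outcome_law : ∀ t, 1 ≤ t → Q.map (X t) = P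
  outcome_indep : ∀ t, 1 ≤ t →
    Indep (MeasurableSpace.comap (X t) inferInstance) (ℱ (t - 1)) Q
  action_measurable : ∀ t, 1 ≤ t → ∀ B : Finset (Fin n),
    MeasurableSet[ℱ (t - 1)] {ω | A t ω = B}

/-- The regret `R_T = E[∑_{t=1}^T (e_{A*} - e_{A_t})ᵀ X_t]`. -/
def regret {n : ℕ} {Ω : Type*} [MeasurableSpace Ω] (Q : Measure Ω) (Astar : Finset (Fin n))
    (X : ℕ → Ω → Fin n → ℝ) (A : ℕ → Ω → Finset (Fin n)) (T : ℕ) : ℝ :=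
  ∫ ω, ∑ t ∈ Finset.Icc 1 T, (total Astar (X t ω) - total (A t ω) (X t ω)) ∂Q

/-! The remaining definitions concern one trajectory: `a t` is the action and `x t` the outcome
vector of round `t ≥ 1`. Only the observed coordinates `x t i`, `i ∈ a t`, are ever used. -/

/-- The counter `N_{i,t}`: the number of rounds `u ∈ {1, …, t}` in which arm `i` was played. -/
def counter {n : ℕ} (a : ℕ → Finset (Fin n)) (t : ℕ) (i : Fin n) : ℕ :=
  ((Finset.Icc 1 t).filter (fun u => i ∈ a u)).card

/-- The empirical average of the observed outcomes of arm `i` in rounds `1, …, t`. -/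
def empMean {n : ℕ} (a : ℕ → Finset (Fin n)) (x : ℕ → Fin n → ℝ) (t : ℕ) (i : Fin n) : ℝ :=
  (∑ u ∈ Finset.Icc 1 t, if i ∈ a u then x u i else 0) / (counter a t i : ℝ)

/-- The empirical average of the observed `|x u i|` of arm `i` in rounds `1, …, t`. -/
def empAbsMean {n : ℕ} (a : ℕ → Finset (Fin n)) (x : ℕ → Fin n → ℝ) (t : ℕ) (i : Fin n) : ℝ :=
  (∑ u ∈ Finset.Icc 1 t, if i ∈ a u then |x u i| else 0) / (counter a t i : ℝ)

/-- The upper confidence estimate `ν_{i,t}` of `ν*_i` used in round `t`; it is computed from the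
rounds `1, …, t - 1`. -/
def absMeanUpper {n : ℕ} (a : ℕ → Finset (Fin n)) (x : ℕ → Fin n → ℝ) (t : ℕ) (i : Fin n) : ℝ :=
  empAbsMean a x (t - 1) i + Real.sqrt (1.5 * Real.log t / (counter a (t - 1) i : ℝ))

/-- The confidence region `𝒞_t` used in round `t`: the vectors `μ̄_{t-1} + ξ` with
`∑_i N_{i,t-1} ξ_i² / (m |ξ_i| + 2 (s ∧ m) ν_{i,t}) ≤ 8 (log t + log log t) + 4 e m`. -/
def confRegion {n : ℕ} (m : ℕ) (s : ℝ) (a : ℕ → Finset (Fin n)) (x : ℕ → Fin n → ℝ) (t : ℕ) :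
    Set (Fin n → ℝ) :=
  {μ | ∃ ξ : Fin n → ℝ, μ = empMean a x (t - 1) + ξ ∧
    ∑ i, (counter a (t - 1) i : ℝ) * ξ i ^ 2 /
        (m * |ξ i| + 2 * min s m * absMeanUpper a x t i)
      ≤ 8 * (Real.log t + Real.log (Real.log t)) + 4 * Real.exp 1 * m}

/-- The trajectory `(a, x)` is one of the sparse variant of ESCB-C with action space `𝒜` and
sparsity parameter `s`: during the initialization, the rounds `1, …, t₀` with `t₀ ≤ n`, actions
(or the full set of arms) are played until all arms have been sampled at least once; in every
later round `t`, the played action is the first component of a maximizer of `e_Aᵀ μ` over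
`A ∈ 𝒜`, `μ ∈ 𝒞_t`. -/
def IsSparseESCBC {n : ℕ} (𝒜 : Finset (Finset (Fin n))) (s : ℝ) (a : ℕ → Finset (Fin n))
    (x : ℕ → Fin n → ℝ) : Prop :=
  ∃ t₀ : ℕ, t₀ ≤ n ∧
    (∀ t ∈ Finset.Icc 1 t₀, a t ∈ 𝒜 ∨ a t = Finset.univ) ∧
    (∀ i : Fin n, ∃ t ∈ Finset.Icc 1 t₀, i ∈ a t) ∧
    ∀ t, t₀ < t →
      a t ∈ 𝒜 ∧ ∃ μ ∈ confRegion (maxSize 𝒜) s a x t,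
        ∀ A ∈ 𝒜, ∀ μ' ∈ confRegion (maxSize 𝒜) s a x t, total A μ' ≤ total (a t) μ

end SemiBandit

end

open MeasureTheory ProbabilityTheory Filter

noncomputable section

namespace SemiBandit

/-! ### Elementary bounds for sums over the values of a counter -/

/-! Write `S = min s m`, `L = log T`, `N_i` for the counters. In a round with accurate estimates,
optimism bounds the gap of the played action by two sums of deviations over its arms: that of the
chosen `ξ` and that of the empirical means. Both satisfy the quadratic-over-linear constraint, which
`abs_le_confTerm` inverts arm by arm. Cauchy–Schwarz and `ν_{i,t} ≤ ν*_i + O(√(L/N_i))` then leave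
three cases (`gap_trichotomy`): the gap is `O(Lm/N_j)` for some played arm `j`, or its square is
`O(∑ L ν*_i S/N_i)`, or its square is `O(∑ L^{3/2} S/N_i^{3/2})`.

In each case the gap is paid by charges to the played arms that depend only on their counters. Since
playing an arm raises its counter, summing over rounds means summing over counter values. Up to
constants, the totals for arm `i` are `Lm(1 + log(Δmax/Δ))`, `L ν*_i S log(4m)/Δ` and `L
(ΔS)^{2/3}/Δ` (`sum_armCharge_le`). After multiplication by `Δ`, the smallness assumption absorbs
the first and the third into the second (`mul_sum_armCharge_le`). What results is linear in
`log(m+1)`; the square is reached through `log(m+1) ≥ log 2`.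

Inaccurate rounds cost a constant: exponential supermartingales, with exponents from a geometric
grid, give them probability `O(t⁻²)` (`IsInteraction.exists_measure_not_goodRound_le`). Sparsity
enters through `Z² ≤ S ∑ l_i² |x_i|` for `Z = ∑ l_i x_i` (`lintegral_exp_le_one_of_sparse`). -/

theorem sum_Ico_le_of_le_sub {h Φ : ℕ → ℝ} {a b : ℕ} (hab : a ≤ b)
    (hΦ : ∀ k, a ≤ k → h k ≤ Φ (k + 1) - Φ k) :
    ∑ k ∈ Finset.Ico a b, h k ≤ Φ b - Φ a := by
  induction b, hab using Nat.le_induction with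
  | base => simp
  | succ b hab ih =>
    rw [Finset.sum_Ico_succ_top hab]
    linarith [hΦ b hab]

/-- The index `0` is harmless because the summands below are inverse powers, which vanish there by
the convention `1 / 0 = 0`. -/
theorem sum_filter_range_le_sum_Ico {h : ℕ → ℝ} {p : ℕ → Prop} [DecidablePred p] {a b T : ℕ}
    (hh : ∀ k, 0 ≤ h k) (h0 : h 0 = 0) (hp : ∀ k, 1 ≤ k → p k → a ≤ k ∧ k < b) :
    ∑ k ∈ Finset.range T with p k, h k ≤ ∑ k ∈ Finset.Ico a b, h k := by
  have : ∑ k ∈ Finset.range T with p k, h k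
      = ∑ k ∈ Finset.range T with (p k ∧ 1 ≤ k), h k := by
    rw [Finset.sum_filter, Finset.sum_filter]
    refine Finset.sum_congr rfl fun k _ => ?_
    rcases Nat.eq_zero_or_pos k with rfl | hk
    · simp [h0]
    · simp [Nat.succ_le_of_lt hk]
  rw [this]
  refine Finset.sum_le_sum_of_subset_of_nonneg ?_ fun k _ _ => hh k
  intro k hk
  simp only [Finset.mem_filter, Finset.mem_range, Finset.mem_Ico] at hk ⊢
  exact hp k hk.2.2 hk.2.1

theorem one_div_sqrt_le_sub {x : ℝ} (hx : 1 ≤ x) :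
    1 / √x ≤ 3 * √(x + 1) - 3 * √x := by
  have h1 : 0 < √x := Real.sqrt_pos.2 (by linarith)
  have h2 : √x * √x = x := Real.mul_self_sqrt (by linarith)
  have h3 : √(x + 1) * √(x + 1) = x + 1 := Real.mul_self_sqrt (by linarith)
  have h4 : 0 ≤ √(x + 1) := Real.sqrt_nonneg _
  have h5 : √(x + 1) ≤ 2 * √x := by
    apply Real.sqrt_le_iff.2; constructor
    · positivity
    · nlinarith
  rw [div_le_iff₀ h1]
  have : (√(x + 1) - √x) * (√(x + 1) + √x) = 1 := by linear_combination h3 - h2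
  have h6 : √x ≤ √(x + 1) := Real.sqrt_le_sqrt (by linarith)
  nlinarith [mul_nonneg (sub_nonneg.2 h6) (by linarith : 0 ≤ 2 * √x - √(x+1))]

theorem one_div_mul_sqrt_le_sub {x : ℝ} (hx : 1 ≤ x) :
    1 / (x * √x) ≤ -(6 / √(x + 1)) - -(6 / √x) := by
  have h1 : 0 < √x := Real.sqrt_pos.2 (by linarith)
  have h4 : 0 < √(x + 1) := Real.sqrt_pos.2 (by linarith)
  have h := one_div_sqrt_le_sub hx
  have h5 : √(x + 1) ≤ 2 * √x := by
    apply Real.sqrt_le_iff.2; constructor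
    · positivity
    · nlinarith [Real.mul_self_sqrt (by linarith : 0 ≤ x)]
  have h2 : √x * √x = x := Real.mul_self_sqrt (by linarith)
  have e : -(6 / √(x + 1)) - -(6 / √x) = 2 * (3 * √(x + 1) - 3 * √x) / (√x * √(x + 1)) := by
    field_simp; ring
  rw [e]
  have h7 : 1 / (x * √x) = 2 * (1 / √x) / (√x * (2 * √x)) := by
    rw [show √x * (2 * √x) = 2 * x by linear_combination 2 * h2]
    field_simp
  rw [h7]
  have : 0 < 1 / √x := by positivity
  have h8 : 0 ≤ 2 * (3 * √(x + 1) - 3 * √x) := by linarith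
  gcongr

theorem sqrt_mul_sqrt_sqrt_le_sub {x : ℝ} (hx : 1 ≤ x) :
    1 / √(x * √x) ≤ 8 * √√(x + 1) - 8 * √√x := by
  set z := √√x with hz
  set y := √√(x + 1) with hy
  have hz2 : z ^ 2 = √x := Real.sq_sqrt (Real.sqrt_nonneg _)
  have hy2 : y ^ 2 = √(x + 1) := Real.sq_sqrt (Real.sqrt_nonneg _)
  have hz4 : z ^ 4 = x := by
    rw [show z ^ 4 = (z ^ 2) ^ 2 by ring, hz2, Real.sq_sqrt (by linarith)]
  have hy4 : y ^ 4 = x + 1 := by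
    rw [show y ^ 4 = (y ^ 2) ^ 2 by ring, hy2, Real.sq_sqrt (by linarith)]
  have hz0 : 0 < z := Real.sqrt_pos.2 (Real.sqrt_pos.2 (by linarith))
  have hy0 : 0 ≤ y := Real.sqrt_nonneg _
  have hzy : z ≤ y := Real.sqrt_le_sqrt (Real.sqrt_le_sqrt (by linarith))
  have e : √(x * √x) = z ^ 3 := by
    rw [show x * √x = (z ^ 3) ^ 2 by rw [← hz2, ← hz4]; ring]
    exact Real.sqrt_sq (by positivity)
  rw [e, div_le_iff₀ (by positivity)]
  have h5 : y ^ 3 ≤ 2 * z ^ 3 := by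
    have : (y ^ 3) ^ 4 ≤ (2 * z ^ 3) ^ 4 := by
      have : (y ^ 3) ^ 4 = (x + 1) ^ 3 := by rw [← hy4]; ring
      have h' : (2 * z ^ 3) ^ 4 = 16 * x ^ 3 := by rw [← hz4]; ring
      have : (x + 1) ^ 3 ≤ (2 * x) ^ 3 := by gcongr; linarith
      have : 0 ≤ x ^ 3 := by positivity
      nlinarith
    exact le_of_pow_le_pow_left₀ (by norm_num) (by positivity) this
  have h6 : (y - z) * (y ^ 3 + y ^ 2 * z + y * z ^ 2 + z ^ 3) = 1 := by
    linear_combination hy4 - hz4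
  have a1 : y ^ 2 * z ≤ y ^ 3 := by nlinarith [mul_nonneg (sq_nonneg y) (sub_nonneg.2 hzy)]
  have a2 : y * z ^ 2 ≤ y ^ 3 := by
    have : z ^ 2 ≤ y ^ 2 := by gcongr
    nlinarith
  have a3 : z ^ 3 ≤ y ^ 3 := by gcongr
  have : y ^ 3 + y ^ 2 * z + y * z ^ 2 + z ^ 3 ≤ 8 * z ^ 3 := by linarith
  nlinarith [mul_le_mul_of_nonneg_left this (sub_nonneg.2 hzy)]

theorem one_div_le_log_sub {x : ℝ} (hx : 1 ≤ x) :
    1 / x ≤ 2 * Real.log (x + 1) - 2 * Real.log x := by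
  have h1 : Real.log (x / (x + 1)) ≤ x / (x + 1) - 1 :=
    Real.log_le_sub_one_of_pos (by positivity)
  rw [Real.log_div (by linarith) (by linarith)] at h1
  have : 1 / x ≤ 2 * (1 - x / (x + 1)) := by
    have : 1 - x / (x + 1) = 1 / (x + 1) := by field_simp; ring
    rw [this, mul_one_div, div_le_div_iff₀ (by linarith) (by linarith)]
    linarith
  linarith

theorem sum_one_div_le {a b : ℝ} (ha : 0 < a) (hab : a ≤ b) (T : ℕ) :
    ∑ k ∈ Finset.range T with (a < (k : ℕ) ∧ (k : ℝ) ≤ b), 1 / (k : ℝ)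
      ≤ 2 * Real.log (2 * (b / a)) := by
  have hlog : 0 ≤ Real.log (2 * (b / a)) := by
    apply Real.log_nonneg
    have : 1 ≤ b / a := (one_le_div ha).2 hab
    linarith
  set k0 := ⌊a⌋₊ + 1
  set k1 := ⌊b⌋₊ + 1
  have hk : k0 ≤ k1 := by simp only [k0, k1]; gcongr
  have hk0 : a < k0 := by simp only [k0]; push_cast; exact Nat.lt_floor_add_one a
  have hk1 : (1 : ℝ) ≤ k0 := by simp [k0]
  refine (sum_filter_range_le_sum_Ico (a := k0) (b := k1) (fun k => by positivity) (by simp)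
    ?_).trans ?_
  · rintro k - ⟨h1, h2⟩
    exact ⟨Nat.succ_le_of_lt ((Nat.floor_lt ha.le).2 h1), Nat.lt_succ_of_le (Nat.le_floor h2)⟩
  refine (sum_Ico_le_of_le_sub (Φ := fun k : ℕ => 2 * Real.log k) hk fun k hk' => ?_).trans ?_
  · have : (1 : ℝ) ≤ k := hk1.trans (by exact_mod_cast hk')
    have := one_div_le_log_sub this
    push_cast; exact this
  · rw [← mul_sub, ← Real.log_div (by positivity) (by positivity)]
    rcases lt_or_ge b 1 with hb | hb
    · have : ⌊b⌋₊ = 0 := Nat.floor_eq_zero.2 hb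
      have h0 : ⌊a⌋₊ = 0 := Nat.floor_eq_zero.2 (hab.trans_lt hb)
      simp only [k0, k1, this, h0]; simpa using hlog
    · have : (k1 : ℝ) ≤ 2 * b := by
        have := Nat.floor_le (by linarith : 0 ≤ b)
        simp only [k1]; push_cast; linarith
      have : (k1 : ℝ) / k0 ≤ 2 * (b / a) := by
        rw [← mul_div_assoc]; gcongr
      gcongr

theorem sqrt_add_one_le {x : ℝ} (hx : 0 ≤ x) : √(x + 1) ≤ √x + 1 := by
  refine Real.sqrt_le_iff.2 ⟨by positivity, ?_⟩
  nlinarith [Real.sq_sqrt hx, Real.sqrt_nonneg x]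

theorem sum_one_div_sqrt_le {τ : ℝ} (hτ : 0 ≤ τ) (T : ℕ) :
    ∑ k ∈ Finset.range T with ((k : ℕ) : ℝ) ≤ τ, 1 / √(k : ℝ) ≤ 3 * √τ := by
  refine (sum_filter_range_le_sum_Ico (a := 1) (b := ⌊τ⌋₊ + 1) (fun k => by positivity) (by simp)
    ?_).trans ?_
  · exact fun k h1 h2 => ⟨h1, Nat.lt_succ_of_le (Nat.le_floor h2)⟩
  refine (sum_Ico_le_of_le_sub (Φ := fun k : ℕ => 3 * √(k : ℝ)) (by omega) fun k hk' => ?_).trans ?_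
  · have : (1 : ℝ) ≤ k := by exact_mod_cast hk'
    have := one_div_sqrt_le_sub this
    push_cast; exact this
  · have h1 := Nat.floor_le hτ
    have : √((⌊τ⌋₊ + 1 : ℕ) : ℝ) ≤ √τ + 1 := by
      push_cast
      refine (Real.sqrt_le_sqrt (by linarith : (⌊τ⌋₊ : ℝ) + 1 ≤ τ + 1)).trans ?_
      exact sqrt_add_one_le hτ
    simp only [Nat.cast_one, Real.sqrt_one]; linarith

theorem sum_one_div_sqrt_mul_sqrt_le {τ : ℝ} (hτ : 0 ≤ τ) (T : ℕ) :
    ∑ k ∈ Finset.range T with ((k : ℕ) : ℝ) ≤ τ, 1 / √((k : ℝ) * √(k : ℝ)) ≤ 8 * √√τ := by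
  refine (sum_filter_range_le_sum_Ico (a := 1) (b := ⌊τ⌋₊ + 1) (fun k => by positivity) (by simp)
    ?_).trans ?_
  · exact fun k h1 h2 => ⟨h1, Nat.lt_succ_of_le (Nat.le_floor h2)⟩
  refine (sum_Ico_le_of_le_sub (Φ := fun k : ℕ => 8 * √√(k : ℝ)) (by omega) fun k hk' => ?_).trans ?_
  · have : (1 : ℝ) ≤ k := by exact_mod_cast hk'
    have := sqrt_mul_sqrt_sqrt_le_sub this
    push_cast; exact this
  · have h1 := Nat.floor_le hτ
    have : √√((⌊τ⌋₊ + 1 : ℕ) : ℝ) ≤ √√τ + 1 := by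
      push_cast
      have h2 : √((⌊τ⌋₊ : ℝ) + 1) ≤ √τ + 1 := by
        refine (Real.sqrt_le_sqrt (by linarith : (⌊τ⌋₊ : ℝ) + 1 ≤ τ + 1)).trans ?_
        exact sqrt_add_one_le hτ
      refine (Real.sqrt_le_sqrt h2).trans ?_
      exact sqrt_add_one_le (Real.sqrt_nonneg τ)
    simp only [Nat.cast_one, Real.sqrt_one]; linarith

theorem sum_one_div_mul_sqrt_le {τ : ℝ} (hτ : 0 < τ) (T : ℕ) :
    ∑ k ∈ Finset.range T with τ < ((k : ℕ) : ℝ), 1 / ((k : ℝ) * √(k : ℝ)) ≤ 6 / √τ := by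
  have e : ∑ k ∈ Finset.range T with τ < ((k : ℕ) : ℝ), 1 / ((k : ℝ) * √(k : ℝ))
      = ∑ k ∈ Finset.range T with (τ < ((k : ℕ) : ℝ) ∧ k < T), 1 / ((k : ℝ) * √(k : ℝ)) := by
    refine Finset.sum_congr ?_ fun _ _ => rfl
    ext k; simp; tauto
  rw [e]
  refine (sum_filter_range_le_sum_Ico (a := ⌊τ⌋₊ + 1) (b := ⌊τ⌋₊ + 1 + T)
    (fun k => by positivity) (by simp) ?_).trans ?_
  · exact fun k h1 h2 => ⟨Nat.succ_le_of_lt ((Nat.floor_lt hτ.le).2 h2.1), by omega⟩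
  refine (sum_Ico_le_of_le_sub (Φ := fun k : ℕ => -(6 / √(k : ℝ))) (by omega) fun k hk' => ?_).trans ?_
  · have : (1 : ℝ) ≤ k := by exact_mod_cast (by omega : 1 ≤ k)
    have := one_div_mul_sqrt_le_sub this
    push_cast; exact this
  · have h1 : τ ≤ ((⌊τ⌋₊ + 1 : ℕ) : ℝ) := by push_cast; exact (Nat.lt_floor_add_one τ).le
    have h2 : 6 / √((⌊τ⌋₊ + 1 : ℕ) : ℝ) ≤ 6 / √τ := by
      have := Real.sqrt_pos.2 hτ
      gcongr
    have : 0 ≤ 6 / √((⌊τ⌋₊ + 1 + T : ℕ) : ℝ) := by positivity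
    linarith

/-! ### Charging functions -/

/-- The charge of an arm of counter `k` when one counter is below `G / Δ_t`. -/
def chargeMin (G Δ Δmax : ℝ) (k : ℕ) : ℝ :=
  if (k : ℝ) ≤ G / Δ then min Δmax (G / k) else 0

theorem chargeMin_nonneg {G Δ Δmax : ℝ} (hG : 0 ≤ G) (hM : 0 ≤ Δmax) (k : ℕ) :
    0 ≤ chargeMin G Δ Δmax k := by
  unfold chargeMin; split_ifs <;> positivity

/-- Up to `G / Δmax` the charge is capped at `Δmax`, for a total of `G`. Between `G / Δmax` and `G /
Δ` it is harmonic, whence the logarithm of the ratio; beyond, it is zero. -/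
theorem sum_chargeMin_le {G Δ Δmax : ℝ} (hG : 0 ≤ G) (hΔ : 0 < Δ) (hM : Δ ≤ Δmax) (T : ℕ) :
    ∑ k ∈ Finset.range T, chargeMin G Δ Δmax k ≤ G + 2 * G * Real.log (2 * (Δmax / Δ)) := by
  rcases hG.eq_or_lt with rfl | hG
  · have : ∀ k, chargeMin 0 Δ Δmax k = 0 := by
      intro k; unfold chargeMin; simp; intro _; linarith
    simp [this]
  have hM0 : 0 < Δmax := hΔ.trans_le hM
  have h1 : ∀ k : ℕ, chargeMin G Δ Δmax k
      ≤ (if (1 ≤ k ∧ (k : ℝ) ≤ G / Δmax) then Δmax else 0)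
        + (if (G / Δmax < k ∧ (k : ℝ) ≤ G / Δ) then G * (1 / (k : ℝ)) else 0) := by
    intro k
    rcases Nat.eq_zero_or_pos k with rfl | hk
    · simp [chargeMin, hM0.le]
    unfold chargeMin
    have hk' : 1 ≤ k := hk
    have : 0 ≤ G * (1 / (k : ℝ)) := by positivity
    by_cases ha : (k : ℝ) ≤ G / Δmax <;> by_cases hb : (k : ℝ) ≤ G / Δ
    · simp [ha, hb, hk', not_lt.2 ha]
    · simp [ha, hb, hk', hM0.le]
    · rw [if_pos hb, if_neg (by tauto), if_pos ⟨lt_of_not_ge ha, hb⟩, zero_add]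
      exact (min_le_right _ _).trans (le_of_eq (by ring))
    · simp [ha, hb]
  refine (Finset.sum_le_sum fun k _ => h1 k).trans ?_
  rw [Finset.sum_add_distrib]
  refine add_le_add ?_ ?_
  · rw [← Finset.sum_filter, Finset.sum_const, nsmul_eq_mul]
    have : (Finset.range T).filter (fun k : ℕ => 1 ≤ k ∧ (k : ℝ) ≤ G / Δmax)
        ⊆ Finset.Icc 1 ⌊G / Δmax⌋₊ := by
      intro k hk
      simp only [Finset.mem_filter, Finset.mem_Icc] at hk ⊢
      exact ⟨hk.2.1, Nat.le_floor hk.2.2⟩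
    have h2 := Finset.card_le_card this
    have h3 : (((Finset.range T).filter (fun k : ℕ => 1 ≤ k ∧ (k : ℝ) ≤ G / Δmax)).card : ℝ)
        ≤ G / Δmax := by
      refine le_trans ?_ (Nat.floor_le (by positivity : 0 ≤ G / Δmax))
      simpa using h2
    calc _ ≤ G / Δmax * Δmax := by gcongr
      _ = G := by field_simp
  · rw [← Finset.sum_filter, ← Finset.mul_sum]
    have := sum_one_div_le (a := G / Δmax) (b := G / Δ) (by positivity) (by gcongr) T
    have e : G / Δ / (G / Δmax) = Δmax / Δ := by field_simp
    rw [e] at this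
    nlinarith [mul_le_mul_of_nonneg_left this hG.le]

/-- The charge of an arm whose contribution to the squared gap is `u ≤ Δ_t²`, with a cutoff
for contributions that are negligible. -/
def chargeSq (Δ M u : ℝ) : ℝ :=
  if Δ ^ 2 ≤ 2 * M * u then min (2 * u / Δ) (2 * √u) else 0

theorem chargeSq_nonneg {Δ M u : ℝ} (hΔ : 0 < Δ) (hu : 0 ≤ u) : 0 ≤ chargeSq Δ M u := by
  unfold chargeSq; split_ifs <;> positivity

theorem chargeSq_le_min {Δ M u : ℝ} (hΔ : 0 < Δ) (hu : 0 ≤ u) :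
    chargeSq Δ M u ≤ min (2 * u / Δ) (2 * √u) := by
  unfold chargeSq; split_ifs
  · rfl
  · positivity

/-- If some `u i` reaches `d²`, that arm pays `d` alone. Otherwise `∑ 2 u i / d ≥ 2 d`, and giving
up `d / M` on each of at most `M` arms still leaves `d`. This slack allows arms with `u i < d² /
(2M)` to be charged nothing. The charge is expressed with `Δ` instead of `d` so that it depends on
the counter only. -/
theorem le_sum_chargeSq {ι : Type*} {s : Finset ι} {u : ι → ℝ} {d Δ M : ℝ} (hΔ : 0 < Δ)
    (hd : Δ ≤ d) (hu : ∀ i ∈ s, 0 ≤ u i) (hM : (s.card : ℝ) ≤ M) (hM1 : 1 ≤ M)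
    (h : d ^ 2 ≤ ∑ i ∈ s, u i) :
    d ≤ ∑ i ∈ s, chargeSq Δ M (u i) := by
  have hd0 : 0 < d := hΔ.trans_le hd
  have hsq : Δ ^ 2 ≤ d ^ 2 := by gcongr
  by_cases hc : ∃ i ∈ s, d ^ 2 ≤ u i
  · obtain ⟨i, hi, hdi⟩ := hc
    refine le_trans ?_ (Finset.single_le_sum (fun j hj => chargeSq_nonneg (M := M) hΔ (hu j hj)) hi)
    have h0 : 0 ≤ u i := hu i hi
    have hs : d ≤ √(u i) := Real.le_sqrt_of_sq_le hdi
    unfold chargeSq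
    rw [if_pos (by nlinarith)]
    refine le_min ?_ (by linarith)
    rw [le_div_iff₀ hΔ]
    nlinarith
  · push Not at hc
    have hterm : ∀ i ∈ s, 2 * u i / d - d / M ≤ chargeSq Δ M (u i) := by
      intro i hi
      have h0 : 0 ≤ u i := hu i hi
      by_cases hcut : d ^ 2 ≤ 2 * M * u i
      · have : 0 ≤ d / M := by positivity
        unfold chargeSq
        rw [if_pos (hsq.trans hcut)]
        have h1 : 2 * u i / d ≤ 2 * u i / Δ := by gcongr
        -- Here `u i < d²` is what permits the cap by the square root.
        have h2 : 2 * u i / d ≤ 2 * √(u i) := by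
          rw [div_le_iff₀ hd0]
          have : √(u i) ≤ d := Real.sqrt_le_iff.2 ⟨hd0.le, (hc i hi).le⟩
          nlinarith [Real.mul_self_sqrt h0, Real.sqrt_nonneg (u i)]
        refine le_min ?_ ?_ <;> linarith
      · refine le_trans ?_ (chargeSq_nonneg hΔ h0)
        rw [sub_nonpos, div_le_div_iff₀ hd0 (by linarith)]
        nlinarith
    have := Finset.sum_le_sum hterm
    rw [Finset.sum_sub_distrib, Finset.sum_const, nsmul_eq_mul, ← Finset.sum_div,
      ← Finset.mul_sum] at this
    have h3 : 2 * d ≤ 2 * (∑ i ∈ s, u i) / d := by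
      rw [le_div_iff₀ hd0]; nlinarith
    have h4 : (s.card : ℝ) * (d / M) ≤ d := by
      rw [mul_div_assoc', div_le_iff₀ (by linarith)]; nlinarith
    linarith

/-- The square-root cap serves up to `k = g / Δ²`. From there the sum is harmonic, and the cutoff
stops it at `2 M g / Δ²`: this turns a factor `log T` into `log (4 M)`. -/
theorem sum_chargeSq_div_le {g Δ M : ℝ} (hg : 0 ≤ g) (hΔ : 0 < Δ) (hM : 1 ≤ M) (T : ℕ) :
    ∑ k ∈ Finset.range T, chargeSq Δ M (g / (k : ℝ)) ≤ g / Δ * (6 + 4 * Real.log (4 * M)) := by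
  rcases hg.eq_or_lt with rfl | hg
  · simp [chargeSq]
  have h1 : ∀ k : ℕ, chargeSq Δ M (g / (k : ℝ))
      ≤ (if ((k : ℝ) ≤ g / Δ ^ 2) then 2 * √g * (1 / √(k : ℝ)) else 0)
        + (if (g / Δ ^ 2 < k ∧ (k : ℝ) ≤ 2 * M * g / Δ ^ 2) then 2 * g / Δ * (1 / (k : ℝ)) else 0) := by
    intro k
    have hu : 0 ≤ g / (k : ℝ) := by positivity
    have hmin := chargeSq_le_min (M := M) hΔ hu
    by_cases ha : (k : ℝ) ≤ g / Δ ^ 2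
    · rw [if_pos ha, if_neg (by intro h; linarith [h.1]), add_zero]
      refine hmin.trans ((min_le_right _ _).trans (le_of_eq ?_))
      rw [Real.sqrt_div' _ (by positivity)]; ring
    · rw [if_neg ha, zero_add]
      have ha' := lt_of_not_ge ha
      by_cases hb : (k : ℝ) ≤ 2 * M * g / Δ ^ 2
      · rw [if_pos ⟨ha', hb⟩]
        refine hmin.trans ((min_le_left _ _).trans (le_of_eq ?_))
        ring
      · rw [if_neg (by tauto)]
        have hk : 0 < (k : ℝ) := lt_of_le_of_lt (by positivity) ha'
        unfold chargeSq
        rw [if_neg]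
        intro hle
        apply hb
        rw [le_div_iff₀ (by positivity)]
        have : 2 * M * (g / k) = (2 * M * g) / k := by ring
        rw [this, le_div_iff₀ hk] at hle
        linarith
  refine (Finset.sum_le_sum fun k _ => h1 k).trans ?_
  rw [Finset.sum_add_distrib, ← Finset.sum_filter, ← Finset.sum_filter, ← Finset.mul_sum,
    ← Finset.mul_sum]
  have s1 := sum_one_div_sqrt_le (τ := g / Δ ^ 2) (by positivity) T
  have s2 := sum_one_div_le (a := g / Δ ^ 2) (b := 2 * M * g / Δ ^ 2) (by positivity)
    (by gcongr; nlinarith) T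
  have e1 : 2 * √g * (3 * √(g / Δ ^ 2)) = g / Δ * 6 := by
    rw [Real.sqrt_div' _ (by positivity), Real.sqrt_sq hΔ.le]
    field_simp
    linear_combination 6 * Real.mul_self_sqrt hg.le
  have e2 : 2 * (2 * M * g / Δ ^ 2 / (g / Δ ^ 2)) = 4 * M := by field_simp; ring
  rw [e2] at s2
  calc _ ≤ 2 * √g * (3 * √(g / Δ ^ 2)) + 2 * g / Δ * (2 * Real.log (4 * M)) := by gcongr
    _ = _ := by rw [e1]; ring

/-- The contribution is `Δ² (τ / k)^{3/2}`, which equals `Δ²` at `k = τ`, where the two caps are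
exchanged. As `k^{-3/2}` is summable, no logarithm appears; the two ranges give `16` and `12`. -/
theorem sum_chargeSq_div_mul_sqrt_le {τ Δ M : ℝ} (hτ : 0 < τ) (hΔ : 0 < Δ) (T : ℕ) :
    ∑ k ∈ Finset.range T, chargeSq Δ M (Δ ^ 2 * (τ * √τ) / ((k : ℝ) * √(k : ℝ)))
      ≤ 28 * (Δ * τ) := by
  have h1 : ∀ k : ℕ, chargeSq Δ M (Δ ^ 2 * (τ * √τ) / ((k : ℝ) * √(k : ℝ)))
      ≤ (if ((k : ℝ) ≤ τ) then 2 * (Δ * √(τ * √τ)) * (1 / √((k : ℝ) * √(k : ℝ))) else 0)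
        + (if (τ < k) then 2 * Δ * (τ * √τ) * (1 / ((k : ℝ) * √(k : ℝ))) else 0) := by
    intro k
    have hmin := chargeSq_le_min (M := M) hΔ
      (by positivity : 0 ≤ Δ ^ 2 * (τ * √τ) / ((k : ℝ) * √(k : ℝ)))
    by_cases ha : (k : ℝ) ≤ τ
    · rw [if_pos ha, if_neg (not_lt.2 ha), add_zero]
      refine hmin.trans ((min_le_right _ _).trans (le_of_eq ?_))
      rw [Real.sqrt_div' _ (by positivity), Real.sqrt_mul (by positivity), Real.sqrt_sq hΔ.le]
      ring
    · rw [if_neg ha, if_pos (lt_of_not_ge ha), zero_add]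
      refine hmin.trans ((min_le_left _ _).trans (le_of_eq ?_))
      field_simp
  refine (Finset.sum_le_sum fun k _ => h1 k).trans ?_
  rw [Finset.sum_add_distrib, ← Finset.sum_filter, ← Finset.sum_filter, ← Finset.mul_sum,
    ← Finset.mul_sum]
  have s1 := sum_one_div_sqrt_mul_sqrt_le hτ.le T
  have s2 := sum_one_div_mul_sqrt_le hτ T
  have hs : 0 < √τ := Real.sqrt_pos.2 hτ
  have e1 : √(τ * √τ) * √√τ = τ := by
    rw [← Real.sqrt_mul (by positivity), mul_assoc, Real.mul_self_sqrt hτ.le]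
    exact Real.sqrt_mul_self hτ.le
  calc _ ≤ 2 * (Δ * √(τ * √τ)) * (8 * √√τ) + 2 * Δ * (τ * √τ) * (6 / √τ) := by gcongr
    _ = 28 * (Δ * τ) := by
      field_simp
      linear_combination 16 * e1

/-! ### Counters -/

section counter

variable {n : ℕ}

theorem counter_succ (a : ℕ → Finset (Fin n)) (t : ℕ) (i : Fin n) :
    counter a (t + 1) i = counter a t i + if i ∈ a (t + 1) then 1 else 0 := by
  unfold counter
  rw [← Finset.insert_Icc_right_eq_Icc_add_one (by omega : 1 ≤ t + 1), Finset.filter_insert]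
  split_ifs
  · rw [Finset.card_insert_of_notMem (by simp)]
  · rfl

theorem counter_zero (a : ℕ → Finset (Fin n)) (i : Fin n) : counter a 0 i = 0 := by
  simp [counter]

theorem counter_le (a : ℕ → Finset (Fin n)) (t : ℕ) (i : Fin n) : counter a t i ≤ t := by
  unfold counter
  exact (Finset.card_filter_le _ _).trans (by simp)

theorem counter_pos {a : ℕ → Finset (Fin n)} {t u : ℕ} {i : Fin n} (hu : u ∈ Finset.Icc 1 t)
    (hi : i ∈ a u) : 1 ≤ counter a t i :=
  Finset.card_pos.2 ⟨u, by simp only [Finset.mem_filter]; exact ⟨hu, hi⟩⟩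

theorem sum_mem_counter_eq (a : ℕ → Finset (Fin n)) (i : Fin n) (h : ℕ → ℝ) (T : ℕ) :
    ∑ t ∈ Finset.Icc 1 T, (if i ∈ a t then h (counter a (t - 1) i) else 0)
      = ∑ k ∈ Finset.range (counter a T i), h k := by
  induction T with
  | zero => simp [counter_zero]
  | succ T ih =>
    rw [Finset.sum_Icc_succ_top (by omega), ih, counter_succ]
    split_ifs
    · simp [Finset.sum_range_succ]
    · simp

/-- The rounds that play a fixed arm see its counter at `0, 1, 2, …`, each value once. -/
theorem sum_sum_counter_le (a : ℕ → Finset (Fin n)) {h : Fin n → ℕ → ℝ}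
    (hh : ∀ i k, 0 ≤ h i k) (T : ℕ) :
    ∑ t ∈ Finset.Icc 1 T, ∑ i ∈ a t, h i (counter a (t - 1) i)
      ≤ ∑ i, ∑ k ∈ Finset.range T, h i k := by
  have : ∀ t, ∑ i ∈ a t, h i (counter a (t - 1) i)
      = ∑ i, if i ∈ a t then h i (counter a (t - 1) i) else 0 := by
    intro t; rw [Finset.sum_ite_mem, Finset.univ_inter]
  simp_rw [this]
  rw [Finset.sum_comm]
  refine Finset.sum_le_sum fun i _ => ?_
  rw [sum_mem_counter_eq a i (h i) T]
  exact Finset.sum_le_sum_of_subset_of_nonneg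
    (Finset.range_mono (counter_le a T i)) fun k _ _ => hh i k

end counter

/-! ### Geometry of the confidence region -/

/-- The contribution of one arm to the constraint that defines the confidence region. -/
def confTerm (m S N ν ξ : ℝ) : ℝ := N * ξ ^ 2 / (m * |ξ| + 2 * S * ν)

theorem confTerm_nonneg {m S N ν ξ : ℝ} (hm : 0 ≤ m) (hS : 0 ≤ S) (hN : 0 ≤ N) (hν : 0 ≤ ν) :
    0 ≤ confTerm m S N ν ξ := by
  unfold confTerm; positivity

theorem confTerm_neg (m S N ν ξ : ℝ) : confTerm m S N ν (-ξ) = confTerm m S N ν ξ := by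
  simp [confTerm]

theorem confTerm_anti {m S N ν ν' ξ : ℝ} (hm : 0 < m) (hS : 0 ≤ S) (hN : 0 ≤ N) (hν : 0 ≤ ν)
    (h : ν ≤ ν') : confTerm m S N ν' ξ ≤ confTerm m S N ν ξ := by
  rcases eq_or_ne ξ 0 with rfl | hξ
  · simp [confTerm]
  have : 0 < |ξ| := abs_pos.2 hξ
  unfold confTerm
  gcongr

/-- With `D` the value of the term, `|ξ|` solves `y² = p y + q` for `p = m D / N` and `q = 2 S ν D /
N`, and a nonnegative root is at most `p + √q`. -/
theorem abs_le_confTerm {m S N ν ξ : ℝ} (hm : 0 ≤ m) (hS : 0 < S) (hN : 0 < N) (hν : 0 < ν) :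
    |ξ| ≤ m * (confTerm m S N ν ξ / N) + √(confTerm m S N ν ξ) * √(2 * S * ν / N) := by
  set D := confTerm m S N ν ξ with hD
  have hD0 : 0 ≤ D := confTerm_nonneg hm hS.le hN.le hν.le
  have hden : 0 < m * |ξ| + 2 * S * ν := by positivity
  have h1 : ξ ^ 2 = D / N * (m * |ξ| + 2 * S * ν) := by
    rw [hD, confTerm]; field_simp
  rw [← Real.sqrt_mul hD0]
  have hq : D * (2 * S * ν / N) = D / N * (2 * S * ν) := by ring
  rw [hq]
  set q := D / N * (2 * S * ν) with hq'
  have hq0 : 0 ≤ q := by positivity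
  have h2 : |ξ| ^ 2 = m * (D / N) * |ξ| + q := by rw [sq_abs, h1]; ring
  by_contra hlt
  push Not at hlt
  have hp : 0 ≤ m * (D / N) := by positivity
  have hs := Real.sqrt_nonneg q
  have hsq := Real.mul_self_sqrt hq0
  nlinarith [abs_nonneg ξ]

theorem sum_abs_le_of_sum_confTerm_le {ι : Type*} {s : Finset ι} {N ν ξ : ι → ℝ} {m S F r : ℝ}
    (hm : 0 ≤ m) (hS : 0 < S) (hN : ∀ i ∈ s, 0 < N i) (hν : ∀ i ∈ s, 0 < ν i) (hr : 0 < r)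
    (hrN : ∀ i ∈ s, r ≤ N i) (h : ∑ i ∈ s, confTerm m S (N i) (ν i) (ξ i) ≤ F) :
    ∑ i ∈ s, |ξ i| ≤ m * F / r + √F * √(∑ i ∈ s, 2 * S * ν i / N i) := by
  have h0 : ∀ i ∈ s, 0 ≤ confTerm m S (N i) (ν i) (ξ i) := fun i hi =>
    confTerm_nonneg hm hS.le (hN i hi).le (hν i hi).le
  refine (Finset.sum_le_sum fun i hi => abs_le_confTerm hm hS (hN i hi) (hν i hi)).trans ?_
  rw [Finset.sum_add_distrib, ← Finset.mul_sum]
  refine add_le_add ?_ ?_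
  · rw [mul_div_assoc]
    gcongr
    calc ∑ i ∈ s, confTerm m S (N i) (ν i) (ξ i) / N i
        ≤ ∑ i ∈ s, confTerm m S (N i) (ν i) (ξ i) / r :=
          Finset.sum_le_sum fun i hi => by
            have := h0 i hi; have := hrN i hi; gcongr
      _ = (∑ i ∈ s, confTerm m S (N i) (ν i) (ξ i)) / r := by rw [Finset.sum_div]
      _ ≤ F / r := by gcongr
  · have e : ∀ (f g : ι → ℝ), (∀ i ∈ s, 0 ≤ f i) → (∀ i ∈ s, 0 ≤ g i) →
        ∑ i ∈ s, √(f i) * √(g i) ≤ √(∑ i ∈ s, f i) * √(∑ i ∈ s, g i) := by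
      intro f g hf hg
      have := Real.sum_mul_le_sqrt_mul_sqrt s (fun i => √(f i)) (fun i => √(g i))
      rwa [Finset.sum_congr rfl fun i hi => Real.sq_sqrt (hf i hi),
        Finset.sum_congr rfl fun i hi => Real.sq_sqrt (hg i hi)] at this
    refine (e _ _ h0 fun i hi => ?_).trans ?_
    · have := hν i hi; have := hN i hi; positivity
    · gcongr

/-- Let `P`, `R` be the last two sums. Each deviation sum is at most `9 L m / N j + (√P + √R) / 6`,
where `j` has the least counter. Adding two of them and asking that one of three parts exceed `d /
3` gives `54 = 3 * 18`, `648 = 36 * 18` and `1728 = 36 * 48`; the `48` comes from `√1.5 ≤ 4 / 3`. -/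
theorem gap_trichotomy {ι : Type*} {s : Finset ι} {N ν ν' ξ η : ι → ℝ} {m S L d : ℝ}
    (hs : s.Nonempty) (hm : 0 ≤ m) (hS : 0 < S) (hL : 0 ≤ L) (hN : ∀ i ∈ s, 0 < N i)
    (hν : ∀ i ∈ s, 0 ≤ ν i) (hν' : ∀ i ∈ s, 0 < ν' i)
    (hνν' : ∀ i ∈ s, ν' i ≤ ν i + 2 * √(1.5 * L / N i))
    (hξ : ∑ i ∈ s, confTerm m S (N i) (ν' i) (ξ i) ≤ 9 * L)
    (hη : ∑ i ∈ s, confTerm m S (N i) (ν' i) (η i) ≤ 9 * L)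
    (hd0 : 0 < d) (hd : d ≤ ∑ i ∈ s, |ξ i| + ∑ i ∈ s, |η i|) :
    (∃ j ∈ s, d ≤ 54 * L * m / N j) ∨ d ^ 2 ≤ ∑ i ∈ s, 648 * L * (ν i * S) / N i ∨
      d ^ 2 ≤ ∑ i ∈ s, 1728 * (L * √L) * S / (N i * √(N i)) := by
  obtain ⟨j, hj, hjmin⟩ := Finset.exists_min_image s N hs
  set P := ∑ i ∈ s, 648 * L * (ν i * S) / N i with hP
  set R := ∑ i ∈ s, 1728 * (L * √L) * S / (N i * √(N i)) with hR
  have hP0 : 0 ≤ P := Finset.sum_nonneg fun i hi => by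
    have := hν i hi; have := hN i hi; positivity
  have hR0 : 0 ≤ R := Finset.sum_nonneg fun i hi => by
    have := hN i hi; positivity
  have hV : 9 * L * ∑ i ∈ s, 2 * S * ν' i / N i ≤ (P + R) / 36 := by
    rw [hP, hR, ← Finset.sum_add_distrib, Finset.mul_sum, Finset.sum_div]
    refine Finset.sum_le_sum fun i hi => ?_
    have hNi := hN i hi
    have hsN : 0 < √(N i) := Real.sqrt_pos.2 hNi
    have e1 : √(1.5 * L / N i) ≤ 4 / 3 * √L / √(N i) := by
      rw [Real.sqrt_div' _ hNi.le]
      gcongr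
      rw [show (4 : ℝ) / 3 = √((4 / 3) ^ 2) by rw [Real.sqrt_sq (by norm_num)],
        ← Real.sqrt_mul (by positivity)]
      apply Real.sqrt_le_sqrt
      nlinarith
    have e2 : ν' i ≤ ν i + 8 / 3 * √L / √(N i) := by
      refine (hνν' i hi).trans ?_
      have : 2 * (4 / 3 * √L / √(N i)) = 8 / 3 * √L / √(N i) := by ring
      linarith
    calc 9 * L * (2 * S * ν' i / N i) ≤ 9 * L * (2 * S * (ν i + 8 / 3 * √L / √(N i)) / N i) := by
          gcongr
      _ = (648 * L * (ν i * S) / N i + 1728 * (L * √L) * S / (N i * √(N i))) / 36 := by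
          field_simp; ring
  have key : ∀ ζ : ι → ℝ, ∑ i ∈ s, confTerm m S (N i) (ν' i) (ζ i) ≤ 9 * L →
      ∑ i ∈ s, |ζ i| ≤ 9 * L * m / N j + (√P + √R) / 6 := by
    intro ζ hζ
    refine (sum_abs_le_of_sum_confTerm_le hm hS hN hν' (hN j hj) hjmin hζ).trans ?_
    rw [← Real.sqrt_mul (by positivity)]
    refine add_le_add (le_of_eq (by ring)) ?_
    refine Real.sqrt_le_iff.2 ⟨by positivity, hV.trans ?_⟩
    nlinarith [Real.sq_sqrt hP0, Real.sq_sqrt hR0, Real.sqrt_nonneg P, Real.sqrt_nonneg R,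
      mul_nonneg (Real.sqrt_nonneg P) (Real.sqrt_nonneg R)]
  by_contra hcon
  push Not at hcon
  obtain ⟨h1, h2, h3⟩ := hcon
  have h1 := h1 j hj
  have h2 : √P < d := (Real.sqrt_lt' hd0).2 h2
  have h3 : √R < d := (Real.sqrt_lt' hd0).2 h3
  have := key ξ hξ
  have := key η hη
  have : 54 * L * m / N j = 6 * (9 * L * m / N j) := by ring
  linarith

/-! ### Rounds in which the estimates are accurate -/

section round

variable {n : ℕ}

/-- The estimates available in round `t` are accurate. -/
def GoodRound (P : Measure (Fin n → ℝ)) (𝒜 : Finset (Finset (Fin n))) (s : ℝ)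
    (a : ℕ → Finset (Fin n)) (x : ℕ → Fin n → ℝ) (t : ℕ) : Prop :=
  (∀ B ∈ 𝒜, ∑ i ∈ B, confTerm (maxSize 𝒜) (min s (maxSize 𝒜)) (counter a (t - 1) i)
      (absMean P i) (empMean a x (t - 1) i - meanVec P i) ≤ 8 * Real.log t + maxSize 𝒜) ∧
    ∀ i, 1 ≤ counter a (t - 1) i → |empAbsMean a x (t - 1) i - absMean P i|
      ≤ √(1.5 * Real.log t / (counter a (t - 1) i : ℝ))

theorem absMean_nonneg (P : Measure (Fin n → ℝ)) (i : Fin n) : 0 ≤ absMean P i :=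
  integral_nonneg fun _ => abs_nonneg _

theorem empAbsMean_nonneg (a : ℕ → Finset (Fin n)) (x : ℕ → Fin n → ℝ) (t : ℕ) (i : Fin n) :
    0 ≤ empAbsMean a x t i := by
  unfold empAbsMean
  exact div_nonneg (Finset.sum_nonneg fun u _ => by split_ifs <;> positivity) (Nat.cast_nonneg _)

theorem log_log_nonneg {t : ℕ} (ht : 3 ≤ t) : 0 ≤ Real.log (Real.log t) := by
  apply Real.log_nonneg
  have h3 : (3 : ℝ) ≤ t := by exact_mod_cast ht
  rw [Real.le_log_iff_exp_le (by linarith)]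
  linarith [Real.exp_one_lt_d9]

theorem GoodRound.gap_trichotomy {P : Measure (Fin n → ℝ)} {𝒜 : Finset (Finset (Fin n))} {s : ℝ}
    {a : ℕ → Finset (Fin n)} {x : ℕ → Fin n → ℝ} {t : ℕ} {Astar : Finset (Fin n)} {L : ℝ}
    (hgood : GoodRound P 𝒜 s a x t) (hS : 0 < min s (maxSize 𝒜 : ℝ))
    (halg : IsSparseESCBC 𝒜 s a x) (hA : Astar ∈ 𝒜) (hnt : n < t) (ht : 3 ≤ t)
    (hL : Real.log t ≤ L)
    (hfL : 8 * (Real.log t + Real.log (Real.log t)) + 4 * Real.exp 1 * maxSize 𝒜 ≤ 9 * L) :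
    a t ∈ 𝒜 ∧ (0 < gap P Astar (a t) →
      (∃ j ∈ a t, gap P Astar (a t) ≤ 54 * L * maxSize 𝒜 / counter a (t - 1) j) ∨
      gap P Astar (a t) ^ 2 ≤ ∑ i ∈ a t, 648 * L * (absMean P i * min s (maxSize 𝒜 : ℝ))
        / counter a (t - 1) i ∨
      gap P Astar (a t) ^ 2 ≤ ∑ i ∈ a t, 1728 * (L * √L) * min s (maxSize 𝒜 : ℝ)
        / (counter a (t - 1) i * √(counter a (t - 1) i : ℝ))) := by
  obtain ⟨t₀, ht₀, -, hinit, hround⟩ := halg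
  obtain ⟨hat, μ, ⟨ξ, rfl, hξ⟩, hmax⟩ := hround t (by omega)
  refine ⟨hat, fun hgap => ?_⟩
  obtain ⟨hg1, hg2⟩ := hgood
  set m : ℝ := (maxSize 𝒜 : ℝ) with hm
  set S := min s m with hSdef
  have hm0 : 0 < m := hS.trans_le (min_le_right _ _)
  have hlog : 0 < Real.log t := Real.log_pos (by exact_mod_cast (by omega : 1 < t))
  have hll := log_log_nonneg ht
  have hcount : ∀ i, 1 ≤ counter a (t - 1) i := by
    intro i
    obtain ⟨u, hu, hi⟩ := hinit i
    refine counter_pos (u := u) ?_ hi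
    simp only [Finset.mem_Icc] at hu ⊢
    omega
  have hN : ∀ i, (0 : ℝ) < counter a (t - 1) i := fun i => by exact_mod_cast hcount i
  have hlow : ∀ i, absMean P i ≤ absMeanUpper a x t i := by
    intro i
    have := (abs_le.1 (hg2 i (hcount i))).1
    unfold absMeanUpper; linarith
  have hup : ∀ i, absMeanUpper a x t i
      ≤ absMean P i + 2 * √(1.5 * L / (counter a (t - 1) i : ℝ)) := by
    intro i
    have h1 := (abs_le.1 (hg2 i (hcount i))).2
    have h2 : √(1.5 * Real.log t / (counter a (t - 1) i : ℝ))
      ≤ √(1.5 * L / (counter a (t - 1) i : ℝ)) := by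
      apply Real.sqrt_le_sqrt; gcongr
    unfold absMeanUpper; linarith
  have hpos : ∀ i, 0 < absMeanUpper a x t i := by
    intro i
    have := hN i
    have : 0 < √(1.5 * Real.log t / (counter a (t - 1) i : ℝ)) := Real.sqrt_pos.2 (by positivity)
    have := empAbsMean_nonneg a x (t - 1) i
    unfold absMeanUpper; linarith
  have hdev : ∀ B ∈ 𝒜, ∑ i ∈ B, confTerm m S (counter a (t - 1) i) (absMeanUpper a x t i)
      (empMean a x (t - 1) i - meanVec P i)
      ≤ 8 * (Real.log t + Real.log (Real.log t)) + 4 * Real.exp 1 * m := by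
    intro B hB
    refine (Finset.sum_le_sum fun i _ => confTerm_anti hm0 hS.le (hN i).le (absMean_nonneg P i)
      (hlow i)).trans ((hg1 B hB).trans ?_)
    have : (1 : ℝ) ≤ Real.exp 1 := Real.one_le_exp zero_le_one
    nlinarith
  set η : Fin n → ℝ := fun i => empMean a x (t - 1) i - meanVec P i with hη
  have hopt : total Astar (meanVec P) ≤ total (a t) (empMean a x (t - 1) + ξ) := by
    -- Optimism does not need all of `μ*` in the region: the estimates are corrected on the arms of
    -- `Astar` only. Hence concentration is required for sums over single actions, with an additive
    -- `m` in place of `n`.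
    set ζ : Fin n → ℝ := fun i => if i ∈ Astar then -η i else 0 with hζ
    have h1 : total Astar (empMean a x (t - 1) + ζ) = total Astar (meanVec P) := by
      refine Finset.sum_congr rfl fun i hi => ?_
      simp [hζ, hη, hi]
    rw [← h1]
    refine hmax Astar hA _ ⟨ζ, rfl, ?_⟩
    refine le_trans (le_of_eq ?_) (hdev Astar hA)
    rw [← Finset.sum_subset (Finset.subset_univ Astar)]
    · refine Finset.sum_congr rfl fun i hi => ?_
      rw [← confTerm_neg]
      simp only [hζ, hη, hi, if_true, confTerm]
      rfl
    · intro i _ hi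
      simp [hζ, hi]
  have hgap_le : gap P Astar (a t) ≤ ∑ i ∈ a t, |ξ i| + ∑ i ∈ a t, |η i| := by
    have h2 : total (a t) (empMean a x (t - 1) + ξ)
        = total (a t) (meanVec P) + ∑ i ∈ a t, (ξ i + η i) := by
      unfold total
      rw [← Finset.sum_add_distrib]
      refine Finset.sum_congr rfl fun i _ => ?_
      simp only [hη, Pi.add_apply]; ring
    have h3 : ∑ i ∈ a t, (ξ i + η i) ≤ ∑ i ∈ a t, |ξ i| + ∑ i ∈ a t, |η i| := by
      rw [← Finset.sum_add_distrib]
      exact Finset.sum_le_sum fun i _ => add_le_add (le_abs_self _) (le_abs_self _)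
    unfold gap; linarith
  have hne : (a t).Nonempty := by
    rw [Finset.nonempty_iff_ne_empty]
    rintro he
    rw [he] at hgap_le hgap
    simp at hgap_le
    linarith
  refine SemiBandit.gap_trichotomy hne hm0.le hS (hlog.le.trans hL) (fun i _ => hN i)
    (fun i _ => absMean_nonneg P i) (fun i _ => hpos i) (fun i _ => hup i) ?_
    ((hdev (a t) hat).trans hfL) hgap hgap_le
  refine le_trans ?_ (hξ.trans hfL)
  exact Finset.sum_le_univ_sum_of_nonneg fun i =>
    confTerm_nonneg hm0.le hS.le (hN i).le (hpos i).le

end round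

/-! ### Exponential supermartingales -/

section supermartingale

variable {n : ℕ} {Ω : Type*} [mΩ : MeasurableSpace Ω] {P : Measure (Fin n → ℝ)} {Q : Measure Ω}
  {ℱ : Filtration ℕ mΩ} {X : ℕ → Ω → Fin n → ℝ} {A : ℕ → Ω → Finset (Fin n)}

theorem IsInteraction.measurable_comp (h : IsInteraction P Q ℱ X A) {ψ : Finset (Fin n) →
    (Fin n → ℝ) → ℝ} (hψ : ∀ B, Measurable (ψ B)) {u t : ℕ} (hu : 1 ≤ u) (hut : u ≤ t) :
    Measurable[ℱ t] fun ω => ψ (A u ω) (X u ω) := by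
  have e : (fun ω => ψ (A u ω) (X u ω))
      = fun ω => ∑ B, {ω | A u ω = B}.indicator (fun ω => ψ B (X u ω)) ω := by
    ext ω
    simp [Set.indicator_apply]
  rw [e]
  refine Finset.measurable_fun_sum _ fun B _ => ?_
  exact ((hψ B).comp ((h.outcome_measurable u hu).mono (ℱ.mono hut) le_rfl)).indicator
    (ℱ.mono ((Nat.sub_le u 1).trans hut) _ (h.action_measurable u hu B))

theorem IsInteraction.measurable_outcome (h : IsInteraction P Q ℱ X A) {u : ℕ} (hu : 1 ≤ u) :
    Measurable (X u) :=
  (h.outcome_measurable u hu).mono (ℱ.le u) le_rfl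

/-- Supermartingale property: splitting by the value of the predictable action makes the last factor
independent of the past, and its mean is at most one for every action. -/
theorem IsInteraction.lintegral_exp_sum_le_one [IsProbabilityMeasure Q]
    (h : IsInteraction P Q ℱ X A)
    {φ : Finset (Fin n) → (Fin n → ℝ) → ℝ} (hφ : ∀ B, Measurable (φ B))
    (h1 : ∀ B, ∫⁻ x, ENNReal.ofReal (Real.exp (φ B x)) ∂P ≤ 1) (t : ℕ) :
    ∫⁻ ω, ENNReal.ofReal (Real.exp (∑ u ∈ Finset.Icc 1 t, φ (A u ω) (X u ω))) ∂Q ≤ 1 := by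
  induction t with
  | zero => simp
  | succ t ih =>
    set f : Ω → ENNReal :=
      fun ω => ENNReal.ofReal (Real.exp (∑ u ∈ Finset.Icc 1 t, φ (A u ω) (X u ω))) with hf
    have hfm : Measurable[ℱ t] f := by
      refine ENNReal.measurable_ofReal.comp (Real.measurable_exp.comp ?_)
      refine Finset.measurable_fun_sum _ fun u hu => ?_
      rw [Finset.mem_Icc] at hu
      exact h.measurable_comp hφ hu.1 hu.2
    have hact : ∀ B, MeasurableSet[ℱ t] {ω | A (t + 1) ω = B} := fun B => by
      simpa using h.action_measurable (t + 1) (by omega) B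
    have e : ∀ ω, ENNReal.ofReal (Real.exp (∑ u ∈ Finset.Icc 1 (t + 1), φ (A u ω) (X u ω)))
        = ∑ B, {ω | A (t + 1) ω = B}.indicator f ω
            * ENNReal.ofReal (Real.exp (φ B (X (t + 1) ω))) := by
      intro ω
      rw [Finset.sum_Icc_succ_top (by omega), Real.exp_add, ENNReal.ofReal_mul (Real.exp_nonneg _)]
      simp [Set.indicator_apply, hf]
    have hg : ∀ B, Measurable fun x => ENNReal.ofReal (Real.exp (φ B x)) := fun B =>
      ENNReal.measurable_ofReal.comp (Real.measurable_exp.comp (hφ B))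
    have hX := h.measurable_outcome (u := t + 1) (by omega)
    have hprod : ∀ B, ∫⁻ ω, {ω | A (t + 1) ω = B}.indicator f ω
            * ENNReal.ofReal (Real.exp (φ B (X (t + 1) ω))) ∂Q
          ≤ ∫⁻ ω, {ω | A (t + 1) ω = B}.indicator f ω ∂Q := by
      intro B
      have hind : Indep (ℱ t) (MeasurableSpace.comap (X (t + 1)) inferInstance) Q := by
        simpa using (h.outcome_indep (t + 1) (by omega)).symm
      have hgX : Measurable[MeasurableSpace.comap (X (t + 1)) inferInstance]
          fun ω => ENNReal.ofReal (Real.exp (φ B (X (t + 1) ω))) :=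
        (hg B).comp (comap_measurable (X (t + 1)))
      rw [lintegral_mul_eq_lintegral_mul_lintegral_of_independent_measurableSpace
        (ℱ.le t) hX.comap_le hind (hfm.indicator (hact B)) hgX]
      have : ∫⁻ ω, ENNReal.ofReal (Real.exp (φ B (X (t + 1) ω))) ∂Q ≤ 1 := by
        rw [← lintegral_map (hg B) hX, h.outcome_law (t + 1) (by omega)]
        exact h1 B
      calc _ ≤ (∫⁻ ω, {ω | A (t + 1) ω = B}.indicator f ω ∂Q) * 1 := by gcongr
        _ = _ := mul_one _
    have hmeas : ∀ B, Measurable ({ω | A (t + 1) ω = B}.indicator f) := fun B =>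
      (hfm.mono (ℱ.le t) le_rfl).indicator (ℱ.le t _ (hact B))
    simp_rw [e]
    have hgX : ∀ B, Measurable fun ω => ENNReal.ofReal (Real.exp (φ B (X (t + 1) ω))) :=
      fun B => (hg B).comp hX
    rw [lintegral_finsetSum _ fun B _ => (hmeas B).fun_mul (hgX B)]
    refine (Finset.sum_le_sum fun B _ => hprod B).trans ?_
    rw [← lintegral_finsetSum _ fun B _ => hmeas B]
    refine le_trans (le_of_eq ?_) ih
    congr 1
    ext ω
    simp [Set.indicator_apply]

theorem IsInteraction.measure_le_sum_le [IsProbabilityMeasure Q] (h : IsInteraction P Q ℱ X A)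
    {φ : Finset (Fin n) → (Fin n → ℝ) → ℝ} (hφ : ∀ B, Measurable (φ B))
    (h1 : ∀ B, ∫⁻ x, ENNReal.ofReal (Real.exp (φ B x)) ∂P ≤ 1) (t : ℕ) (y : ℝ) :
    Q {ω | y ≤ ∑ u ∈ Finset.Icc 1 t, φ (A u ω) (X u ω)} ≤ ENNReal.ofReal (Real.exp (-y)) := by
  have hm : Measurable fun ω =>
      ENNReal.ofReal (Real.exp (∑ u ∈ Finset.Icc 1 t, φ (A u ω) (X u ω))) := by
    refine ENNReal.measurable_ofReal.comp (Real.measurable_exp.comp ?_)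
    refine Finset.measurable_fun_sum _ fun u hu => ?_
    rw [Finset.mem_Icc] at hu
    exact (h.measurable_comp hφ hu.1 le_rfl).mono (ℱ.le u) le_rfl
  have hmarkov := meas_ge_le_lintegral_div (μ := Q) hm.aemeasurable
    (ε := ENNReal.ofReal (Real.exp y)) (by simp [Real.exp_pos]) (by simp)
  refine (measure_mono ?_).trans (hmarkov.trans ?_)
  · intro ω hω
    exact ENNReal.ofReal_le_ofReal (Real.exp_le_exp.2 hω)
  · refine (ENNReal.div_le_div_right (h.lintegral_exp_sum_le_one hφ h1 t) _).trans ?_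
    rw [one_div, ← ENNReal.ofReal_inv_of_pos (Real.exp_pos y), Real.exp_neg]

end supermartingale

/-! ### Exponential moments -/

section moments

variable {n : ℕ} {P : Measure (Fin n → ℝ)} [IsProbabilityMeasure P]

theorem integrable_coord (hb : ∀ᵐ x ∂P, ∀ i, |x i| ≤ 1) (i : Fin n) :
    Integrable (fun x => x i) P :=
  Integrable.of_bound (measurable_pi_apply i).aestronglyMeasurable 1
    (hb.mono fun _ hx => hx i)

theorem integrable_abs_coord (hb : ∀ᵐ x ∂P, ∀ i, |x i| ≤ 1) (i : Fin n) :
    Integrable (fun x => |x i|) P :=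
  (integrable_coord hb i).abs

theorem absMean_le_one (hb : ∀ᵐ x ∂P, ∀ i, |x i| ≤ 1) (i : Fin n) : absMean P i ≤ 1 := by
  unfold absMean
  calc ∫ x, |x i| ∂P ≤ ∫ _, (1 : ℝ) ∂P :=
        integral_mono_ae (integrable_abs_coord hb i) (integrable_const _) (hb.mono fun x hx => hx i)
    _ = 1 := by simp

/-- For `Z = ∑ l i * x i`, the bound `|l i| ≤ 1 / m` gives `|Z| ≤ 1`, hence `exp Z ≤ 1 + Z + Z²`.
Cauchy–Schwarz with weights `|x i|` and `∑_{i ∈ C} |x i| ≤ min s m` bounds `Z²`. Integrating and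
using `1 + y ≤ exp y` finishes; independence of coordinates plays no role. -/
theorem lintegral_exp_le_one_of_sparse {C : Finset (Fin n)} {m s : ℝ} {l : Fin n → ℝ}
    (hb : ∀ᵐ x ∂P, (∀ i, |x i| ≤ 1) ∧ ∑ i, |x i| ≤ s) (hm : 0 < m) (hC : (C.card : ℝ) ≤ m)
    (hl : ∀ i, |l i| ≤ 1 / m) :
    ∫⁻ x, ENNReal.ofReal (Real.exp (∑ i ∈ C, (l i * (x i - meanVec P i)
      - l i ^ 2 * (min s m * absMean P i)))) ∂P ≤ 1 := by
  have hb1 : ∀ᵐ x ∂P, ∀ i, |x i| ≤ 1 := hb.mono fun x hx => hx.1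
  set Z : (Fin n → ℝ) → ℝ := fun x => ∑ i ∈ C, l i * x i with hZ
  set c := ∑ i ∈ C, l i * meanVec P i with hc
  set v := ∑ i ∈ C, l i ^ 2 * (min s m * absMean P i) with hv
  have e : ∀ x : Fin n → ℝ, ∑ i ∈ C, (l i * (x i - meanVec P i)
      - l i ^ 2 * (min s m * absMean P i)) = Z x + (-(c + v)) := by
    intro x
    simp only [hZ, hc, hv, mul_sub, Finset.sum_sub_distrib]; ring
  have hZm : Measurable Z := Finset.measurable_fun_sum _ fun i _ =>
    (measurable_pi_apply i).const_mul _
  have hZi : Integrable Z P := integrable_finsetSum _ fun i _ => (integrable_coord hb1 i).const_mul _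
  have hZint : ∫ x, Z x ∂P = c := by
    simp only [hZ, hc, meanVec]
    rw [integral_finsetSum _ fun i _ => (integrable_coord hb1 i).const_mul _]
    simp_rw [integral_const_mul]
  have hbd : ∀ᵐ x ∂P, |Z x| ≤ 1 ∧ Z x ^ 2 ≤ ∑ i ∈ C, l i ^ 2 * (min s m * |x i|) := by
    filter_upwards [hb] with x ⟨hx1, hxs⟩
    have h1 : ∑ i ∈ C, |x i| ≤ min s m := by
      refine le_min ((Finset.sum_le_univ_sum_of_nonneg fun i => abs_nonneg _).trans hxs) ?_
      refine (Finset.sum_le_sum fun i _ => hx1 i).trans ?_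
      simpa using hC
    constructor
    · calc |Z x| ≤ ∑ i ∈ C, |l i * x i| := Finset.abs_sum_le_sum_abs _ _
        _ ≤ ∑ i ∈ C, 1 / m := by
            refine Finset.sum_le_sum fun i _ => ?_
            rw [abs_mul]
            nlinarith [hl i, hx1 i, abs_nonneg (l i), abs_nonneg (x i)]
        _ ≤ 1 := by
            rw [Finset.sum_const, nsmul_eq_mul, mul_one_div, div_le_one hm]; exact hC
    · have hcs := Finset.sum_sq_le_sum_mul_sum_of_sq_le_mul C (r := fun i => l i * x i)
        (f := fun i => l i ^ 2 * |x i|) (g := fun i => |x i|)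
        (fun i _ => by positivity) (fun i _ => abs_nonneg _)
        (fun i _ => le_of_eq (by rw [mul_assoc, ← sq, sq_abs]; ring))
      refine hcs.trans ?_
      have h2 : 0 ≤ ∑ i ∈ C, l i ^ 2 * |x i| := Finset.sum_nonneg fun i _ => by positivity
      refine (mul_le_mul_of_nonneg_left h1 h2).trans (le_of_eq ?_)
      rw [Finset.sum_mul]
      exact Finset.sum_congr rfl fun i _ => by ring
  have hexp : Integrable (fun x => Real.exp (Z x)) P :=
    Integrable.of_bound (Real.measurable_exp.comp hZm).aestronglyMeasurable (Real.exp 1)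
      (hbd.mono fun x hx => by
        rw [Real.norm_eq_abs, abs_of_pos (Real.exp_pos _)]
        exact Real.exp_le_exp.2 ((le_abs_self _).trans hx.1))
  have hvi : ∀ i ∈ C, Integrable (fun x : Fin n → ℝ => l i ^ 2 * (min s m * |x i|)) P := fun i _ =>
    ((integrable_abs_coord hb1 i).const_mul _).const_mul _
  have h1Z : Integrable (fun x => 1 + Z x) P := (integrable_const _).add hZi
  have hint : ∫ x, Real.exp (Z x) ∂P ≤ 1 + c + v := by
    have h1 : ∫ x, Real.exp (Z x) ∂P
        ≤ ∫ x, (1 + Z x + ∑ i ∈ C, l i ^ 2 * (min s m * |x i|)) ∂P := by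
      refine integral_mono_ae hexp
        (h1Z.add (integrable_finsetSum _ hvi)) ?_
      filter_upwards [hbd] with x hx
      have := (abs_le.1 (Real.abs_exp_sub_one_sub_id_le hx.1)).2
      linarith [hx.2]
    refine h1.trans (le_of_eq ?_)
    rw [integral_add h1Z (integrable_finsetSum _ hvi),
      integral_add (integrable_const _) hZi, hZint, integral_finsetSum _ hvi]
    simp_rw [integral_const_mul]
    simp [hv, absMean]
  simp_rw [e, Real.exp_add]
  rw [← ofReal_integral_eq_lintegral_ofReal (hexp.mul_const _)
    (ae_of_all _ fun x => by positivity), integral_mul_const]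
  rw [ENNReal.ofReal_le_one, Real.exp_neg, ← div_eq_mul_inv, div_le_one (Real.exp_pos _)]
  refine hint.trans ?_
  have := Real.add_one_le_exp (c + v)
  linarith

/-- Hoeffding's lemma for a variable with values in `[0, 1]`. -/
theorem lintegral_exp_abs_le_one (hb : ∀ᵐ x ∂P, ∀ i, |x i| ≤ 1) (i : Fin n) (θ : ℝ) :
    ∫⁻ x, ENNReal.ofReal (Real.exp (θ * (|x i| - absMean P i) - θ ^ 2 / 8)) ∂P ≤ 1 := by
  have hsub := hasSubgaussianMGF_of_mem_Icc (μ := P) (X := fun x : Fin n → ℝ => |x i|)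
    (a := 0) (b := 1) (measurable_pi_apply i).abs.aemeasurable
    (hb.mono fun x hx => ⟨abs_nonneg _, hx i⟩)
  have h1 : ∫ x, Real.exp (θ * (|x i| - absMean P i)) ∂P ≤ _ := hsub.mgf_le θ
  have h2 : Integrable (fun x : Fin n → ℝ => Real.exp (θ * (|x i| - absMean P i))) P :=
    hsub.integrable_exp_mul θ
  simp_rw [sub_eq_add_neg (_ * _) (θ ^ 2 / 8), Real.exp_add]
  rw [← ofReal_integral_eq_lintegral_ofReal (h2.mul_const _)
    (ae_of_all _ fun x => by positivity), integral_mul_const]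
  rw [ENNReal.ofReal_le_one, Real.exp_neg, ← div_eq_mul_inv, div_le_one (Real.exp_pos _)]
  refine h1.trans (le_of_eq ?_)
  norm_num
  ring

end moments

/-! ### A geometric grid of exponents -/

/-- The exponents `0` and `± 2⁻ᵏ / m` for `k ≤ K`. -/
def expGrid (m : ℝ) (K : ℕ) : Finset ℝ :=
  insert 0 ((Finset.range (K + 1)).image (fun k => (1 / 2) ^ k / m)
    ∪ (Finset.range (K + 1)).image (fun k => -((1 / 2) ^ k / m)))

theorem card_expGrid_le (m : ℝ) (K : ℕ) : (expGrid m K).card ≤ 2 * K + 3 := by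
  unfold expGrid
  refine (Finset.card_insert_le _ _).trans ?_
  have h1 := Finset.card_union_le ((Finset.range (K + 1)).image (fun k => (1 / 2 : ℝ) ^ k / m))
    ((Finset.range (K + 1)).image (fun k => -((1 / 2 : ℝ) ^ k / m)))
  have h2 := Finset.card_image_le (s := Finset.range (K + 1)) (f := fun k => (1 / 2 : ℝ) ^ k / m)
  have h3 := Finset.card_image_le (s := Finset.range (K + 1)) (f := fun k => -((1 / 2 : ℝ) ^ k / m))
  rw [Finset.card_range] at h2 h3
  omega

theorem abs_le_of_mem_expGrid {m l : ℝ} {K : ℕ} (hm : 0 < m) (hl : l ∈ expGrid m K) :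
    |l| ≤ 1 / m := by
  have h : ∀ k : ℕ, |(1 / 2 : ℝ) ^ k / m| ≤ 1 / m := by
    intro k
    rw [abs_of_pos (by positivity)]
    gcongr
    exact pow_le_one₀ (by norm_num) (by norm_num)
  simp only [expGrid, Finset.mem_insert, Finset.mem_union, Finset.mem_image] at hl
  rcases hl with rfl | ⟨k, -, rfl⟩ | ⟨k, -, rfl⟩
  · simp [hm.le]
  · exact h k
  · rw [abs_neg]; exact h k

/-- Up to constants, the term is the maximum over `|l| ≤ 1 / m` of a concave quadratic in `l`.
Restricting `l` to the grid makes a union bound possible; the factor `8 / 3` pays for rounding to a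
power of two and the `1` for maximizers below the finest scale. -/
theorem exists_mem_expGrid {m S N ν ξ : ℝ} {K : ℕ} (hm : 1 ≤ m) (hS : 0 ≤ S) (hSm : S ≤ m)
    (hν : 0 ≤ ν) (hν1 : ν ≤ 1) (hN : 0 ≤ N) (hNK : N ≤ 2 ^ K) (hK : 1 ≤ K) :
    ∃ l ∈ expGrid m K, confTerm m S N ν ξ ≤ 8 / 3 * (l * (N * ξ) - N * (l ^ 2 * (S * ν))) + 1 := by
  wlog hξ : 0 ≤ ξ generalizing ξ with H
  · obtain ⟨l, hl, h⟩ := H (ξ := -ξ) (by linarith)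
    refine ⟨-l, ?_, ?_⟩
    · simp only [expGrid, Finset.mem_insert, Finset.mem_union, Finset.mem_image] at hl ⊢
      rcases hl with rfl | ⟨k, hk, rfl⟩ | ⟨k, hk, rfl⟩
      · simp
      · exact Or.inr (Or.inr ⟨k, hk, rfl⟩)
      · exact Or.inr (Or.inl ⟨k, hk, by ring⟩)
    · rw [confTerm_neg] at h
      refine h.trans (le_of_eq (by ring))
  have hmpos : 0 < m := by linarith
  have hmem0 : (0 : ℝ) ∈ expGrid m K := by simp [expGrid]
  have hmem : ∀ k, k ≤ K → (1 / 2 : ℝ) ^ k / m ∈ expGrid m K := by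
    intro k hk
    simp only [expGrid, Finset.mem_insert, Finset.mem_union, Finset.mem_image, Finset.mem_range]
    exact Or.inr (Or.inl ⟨k, by omega, rfl⟩)
  rcases hξ.eq_or_lt with rfl | hξ
  · exact ⟨0, hmem0, by simp [confTerm]⟩
  set V := S * ν with hV
  have hV0 : 0 ≤ V := by positivity
  have hVm : V ≤ m := by nlinarith
  have hD : confTerm m S N ν ξ = N * ξ ^ 2 / (m * ξ + 2 * V) := by
    rw [confTerm, abs_of_pos hξ, hV, mul_assoc 2]
  rw [hD]
  by_cases hcase : 2 * V ≤ m * ξ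
  · refine ⟨(1 / 2) ^ 0 / m, hmem 0 (by omega), ?_⟩
    have h1 : N * ξ ^ 2 / (m * ξ + 2 * V) ≤ N * ξ / m := by
      rw [div_le_div_iff₀ (by positivity) hmpos]
      have : 0 ≤ N * ξ * V := by positivity
      nlinarith
    have h2 : N * (((1 / 2) ^ 0 / m) ^ 2 * V) ≤ N * ξ / m / 2 := by
      have : V ≤ m * ξ / 2 := by linarith
      calc N * (((1 / 2) ^ 0 / m) ^ 2 * V) ≤ N * (((1 / 2) ^ 0 / m) ^ 2 * (m * ξ / 2)) := by gcongr
        _ = _ := by field_simp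
    have h3 : (1 / 2 : ℝ) ^ 0 / m * (N * ξ) = N * ξ / m := by ring
    have h4 : 0 ≤ N * ξ / m := by positivity
    rw [h3]; linarith
  · push Not at hcase
    have hVpos : 0 < V := by nlinarith [mul_pos hmpos hξ]
    -- The unconstrained maximizer is `ξ / (2 V) = r / m`.
    set r := m * ξ / (2 * V) with hr
    have hr0 : 0 < r := by positivity
    have hr1 : r ≤ 1 := by rw [hr, div_le_one (by positivity)]; exact hcase.le
    have hξr : ξ = 2 * V * r / m := by rw [hr]; field_simp
    have h1 : N * ξ ^ 2 / (m * ξ + 2 * V) ≤ N * V / m ^ 2 * (2 * r ^ 2) := by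
      calc N * ξ ^ 2 / (m * ξ + 2 * V) ≤ N * ξ ^ 2 / (2 * V) := by
            gcongr; linarith [mul_pos hmpos hξ]
        _ = N * V / m ^ 2 * (2 * r ^ 2) := by rw [hξr]; field_simp
    have hval : ∀ l : ℝ, l / m * (N * ξ) - N * ((l / m) ^ 2 * V)
        = N * V / m ^ 2 * (2 * l * r - l ^ 2) := by
      intro l; rw [hξr]; field_simp
    have hc0 : 0 ≤ N * V / m ^ 2 := by positivity
    by_cases hrK : r ≤ (1 / 2) ^ K
    · refine ⟨0, hmem0, ?_⟩
      have h2 : N * V / m ^ 2 ≤ 2 ^ K := by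
        rw [div_le_iff₀ (by positivity)]
        have : V ≤ m ^ 2 := by nlinarith
        gcongr
      have h3 : r ^ 2 ≤ ((1 / 2) ^ K) ^ 2 := by gcongr
      have h4 : (2 : ℝ) ^ K * (2 * ((1 / 2) ^ K) ^ 2) = 2 * (1 / 2) ^ K := by
        rw [one_div, inv_pow]; field_simp
      have h5 : (1 / 2 : ℝ) ^ K ≤ (1 / 2) ^ 1 := pow_le_pow_of_le_one (by norm_num) (by norm_num) hK
      have h6 : N * V / m ^ 2 * (2 * r ^ 2) ≤ 2 ^ K * (2 * ((1 / 2) ^ K) ^ 2) := by gcongr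
      simp only [zero_mul, ne_eq, OfNat.ofNat_ne_zero, not_false_eq_true, zero_pow, mul_zero,
        sub_zero, zero_add]
      linarith
    · push Not at hrK
      obtain ⟨k, hk1, hk2⟩ := exists_nat_pow_near_of_lt_one hr0 hr1
        (by norm_num : (0 : ℝ) < 1 / 2) (by norm_num)
      have hkK : k < K := by
        by_contra hcon
        push Not at hcon
        have : (1 / 2 : ℝ) ^ k ≤ (1 / 2) ^ K :=
          pow_le_pow_of_le_one (by norm_num) (by norm_num) hcon
        linarith
      refine ⟨(1 / 2) ^ (k + 1) / m, hmem (k + 1) (by omega), ?_⟩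
      rw [hval]
      have h2 : r ≤ 2 * (1 / 2) ^ (k + 1) := by rw [pow_succ]; linarith
      -- For `q ≤ r ≤ 2 q` the worst case is `r = 2 q`, where equality holds.
      have h3 : 2 * r ^ 2 ≤ 8 / 3 * (2 * (1 / 2) ^ (k + 1) * r - ((1 / 2) ^ (k + 1)) ^ 2) := by
        set q : ℝ := (1 / 2) ^ (k + 1)
        nlinarith [mul_nonneg (sub_nonneg.2 hk1.le) (sub_nonneg.2 h2)]
      have := mul_le_mul_of_nonneg_left h3 hc0
      linarith

/-! ### Probability of an inaccurate round -/

section concentration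

variable {n : ℕ} {Ω : Type*} [mΩ : MeasurableSpace Ω] {P : Measure (Fin n → ℝ)} {Q : Measure Ω}
  {ℱ : Filtration ℕ mΩ} {X : ℕ → Ω → Fin n → ℝ} {A : ℕ → Ω → Finset (Fin n)}

theorem counter_mul_empMean (a : ℕ → Finset (Fin n)) (x : ℕ → Fin n → ℝ) (t : ℕ) (i : Fin n) :
    (counter a t i : ℝ) * empMean a x t i
      = ∑ u ∈ Finset.Icc 1 t, if i ∈ a u then x u i else 0 := by
  unfold empMean
  rcases Nat.eq_zero_or_pos (counter a t i) with h | h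
  · have h' : ∀ u ∈ Finset.Icc 1 t, i ∉ a u := by
      intro u hu hi
      have := counter_pos hu hi
      omega
    rw [Finset.sum_eq_zero fun u hu => if_neg (h' u hu)]
    simp
  · field_simp

theorem sum_mem_sub_eq (a : ℕ → Finset (Fin n)) (x : ℕ → Fin n → ℝ) (t : ℕ) (i : Fin n)
    (l b c : ℝ) :
    ∑ u ∈ Finset.Icc 1 t, (if i ∈ a u then l * (x u i - b) - c else 0)
      = l * (counter a t i * (empMean a x t i - b)) - counter a t i * c := by
  have h : ∀ u, (if i ∈ a u then l * (x u i - b) - c else 0)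
      = l * (if i ∈ a u then x u i else 0) - (l * b + c) * (if i ∈ a u then (1 : ℝ) else 0) := by
    intro u; split_ifs <;> ring
  simp_rw [h]
  rw [Finset.sum_sub_distrib, ← Finset.mul_sum, ← Finset.mul_sum, ← counter_mul_empMean,
    Finset.sum_boole]
  unfold counter
  ring

theorem card_le_maxSize {𝒜 : Finset (Finset (Fin n))} {B : Finset (Fin n)} (hB : B ∈ 𝒜) :
    B.card ≤ maxSize 𝒜 := Finset.le_sup (f := Finset.card) hB

theorem exp_neg_three_mul_log {t : ℕ} (ht : 1 ≤ t) :
    Real.exp (-(3 * Real.log t)) = 1 / (t : ℝ) ^ 3 := by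
  have : (0 : ℝ) < t := by exact_mod_cast ht
  rw [Real.exp_neg, show (3 : ℝ) * Real.log t = ((3 : ℕ) : ℝ) * Real.log t by norm_num,
    Real.exp_nat_mul, Real.exp_log this, one_div]

/-- A large sum forces one supermartingale, indexed by a choice of grid exponents for all arms,
above `3 log t`, since `8 / 3 * 3 = 8`. The additive `1` per arm accounts for `maxSize 𝒜`. The union
bound costs the number of choices. -/
theorem IsInteraction.measure_confTerm_lt [IsProbabilityMeasure P] [IsProbabilityMeasure Q]
    (h : IsInteraction P Q ℱ X A) {𝒜 : Finset (Finset (Fin n))} {s : ℝ}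
    (hb : ∀ᵐ x ∂P, (∀ i, |x i| ≤ 1) ∧ ∑ i, |x i| ≤ s) (hS : 0 < min s (maxSize 𝒜 : ℝ))
    {B : Finset (Fin n)} (hB : B ∈ 𝒜) {t : ℕ} (ht : 2 ≤ t) :
    Q {ω | 8 * Real.log t + maxSize 𝒜 < ∑ i ∈ B, confTerm (maxSize 𝒜) (min s (maxSize 𝒜))
      (counter (fun t => A t ω) (t - 1) i) (absMean P i)
      (empMean (fun t => A t ω) (fun t => X t ω) (t - 1) i - meanVec P i)}
      ≤ ENNReal.ofReal ((2 * Nat.clog 2 t + 3) ^ n * (1 / (t : ℝ) ^ 3)) := by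
  set K := Nat.clog 2 t with hK
  set m : ℝ := (maxSize 𝒜 : ℝ) with hm
  set S := min s m with hSdef
  have hm0 : 0 < m := hS.trans_le (min_le_right _ _)
  have hm1 : 1 ≤ m := by
    rw [hm] at hm0 ⊢; exact_mod_cast (by exact_mod_cast hm0 : 0 < maxSize 𝒜)
  have hBm : (B.card : ℝ) ≤ m := by rw [hm]; exact_mod_cast card_le_maxSize hB
  have hK1 : 1 ≤ K := Nat.clog_pos (by norm_num) ht
  have htK : (t : ℝ) ≤ 2 ^ K := by exact_mod_cast Nat.le_pow_clog (by norm_num) t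
  set Λ := Fintype.piFinset fun _ : Fin n => expGrid m K with hΛ
  set φ : (Fin n → ℝ) → Finset (Fin n) → (Fin n → ℝ) → ℝ := fun l D x =>
    ∑ i ∈ B ∩ D, (l i * (x i - meanVec P i) - l i ^ 2 * (S * absMean P i)) with hφ
  have hφsum : ∀ l ω, ∑ u ∈ Finset.Icc 1 (t - 1), φ l (A u ω) (X u ω)
      = ∑ i ∈ B, (l i * (counter (fun t => A t ω) (t - 1) i
          * (empMean (fun t => A t ω) (fun t => X t ω) (t - 1) i - meanVec P i))
        - counter (fun t => A t ω) (t - 1) i * (l i ^ 2 * (S * absMean P i))) := by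
    intro l ω
    simp only [hφ]
    simp_rw [← sum_mem_sub_eq, ← Finset.sum_ite_mem]
    rw [Finset.sum_comm]
  have hsub : {ω | 8 * Real.log t + m < ∑ i ∈ B, confTerm m S
      (counter (fun t => A t ω) (t - 1) i) (absMean P i)
      (empMean (fun t => A t ω) (fun t => X t ω) (t - 1) i - meanVec P i)}
      ⊆ ⋃ l ∈ Λ, {ω | 3 * Real.log t ≤ ∑ u ∈ Finset.Icc 1 (t - 1), φ l (A u ω) (X u ω)} := by
    intro ω hω
    simp only [Set.mem_ofPred_eq] at hω
    have hex : ∀ i, ∃ l ∈ expGrid m K, confTerm m S (counter (fun t => A t ω) (t - 1) i)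
        (absMean P i) (empMean (fun t => A t ω) (fun t => X t ω) (t - 1) i - meanVec P i)
        ≤ 8 / 3 * (l * (counter (fun t => A t ω) (t - 1) i
          * (empMean (fun t => A t ω) (fun t => X t ω) (t - 1) i - meanVec P i))
          - counter (fun t => A t ω) (t - 1) i * (l ^ 2 * (S * absMean P i))) + 1 := by
      intro i
      refine exists_mem_expGrid hm1 hS.le (min_le_right _ _) (absMean_nonneg P i)
        (absMean_le_one (hb.mono fun x hx => hx.1) i) (Nat.cast_nonneg _) (le_trans ?_ htK) hK1
      exact_mod_cast (counter_le _ _ _).trans (Nat.sub_le t 1)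
    choose l hl hle using hex
    simp only [Set.mem_iUnion, Set.mem_ofPred_eq]
    refine ⟨l, Fintype.mem_piFinset.2 hl, ?_⟩
    rw [hφsum]
    have := Finset.sum_le_sum fun i (_ : i ∈ B) => hle i
    rw [Finset.sum_add_distrib, ← Finset.mul_sum, Finset.sum_const, nsmul_eq_mul, mul_one] at this
    linarith
  refine (measure_mono hsub).trans ((measure_biUnion_finset_le _ _).trans ?_)
  have hone : ∀ l ∈ Λ, Q {ω | 3 * Real.log t ≤ ∑ u ∈ Finset.Icc 1 (t - 1), φ l (A u ω) (X u ω)}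
      ≤ ENNReal.ofReal (1 / (t : ℝ) ^ 3) := by
    intro l hl
    rw [← exp_neg_three_mul_log (by omega : 1 ≤ t)]
    refine h.measure_le_sum_le (fun D => ?_) (fun D => ?_) _ _
    · refine Finset.measurable_fun_sum _ fun i _ => ?_
      exact (((measurable_pi_apply i).sub_const _).const_mul _).sub_const _
    · refine lintegral_exp_le_one_of_sparse hb hm0 (le_trans ?_ hBm) fun i =>
        abs_le_of_mem_expGrid hm0 (Fintype.mem_piFinset.1 hl i)
      exact_mod_cast Finset.card_le_card Finset.inter_subset_left
  refine (Finset.sum_le_sum hone).trans ?_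
  rw [Finset.sum_const, nsmul_eq_mul, ENNReal.ofReal_mul (by positivity)]
  gcongr
  rw [← ENNReal.ofReal_natCast]
  apply ENNReal.ofReal_le_ofReal
  rw [hΛ, Fintype.card_piFinset_const]
  push_cast
  gcongr
  exact_mod_cast card_expGrid_le m K

theorem IsInteraction.measure_empAbsMean_dev_lt [IsProbabilityMeasure P] [IsProbabilityMeasure Q]
    (h : IsInteraction P Q ℱ X A) (hb : ∀ᵐ x ∂P, ∀ i, |x i| ≤ 1) (i : Fin n) {t : ℕ} (ht : 2 ≤ t) :
    Q {ω | 1 ≤ counter (fun t => A t ω) (t - 1) i ∧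
      √(1.5 * Real.log t / (counter (fun t => A t ω) (t - 1) i : ℝ))
        < |empAbsMean (fun t => A t ω) (fun t => X t ω) (t - 1) i - absMean P i|}
      ≤ ENNReal.ofReal (t * (2 * (1 / (t : ℝ) ^ 3))) := by
  have hlog : 0 < Real.log t := Real.log_pos (by exact_mod_cast (by omega : 1 < t))
  set φ : ℝ → Finset (Fin n) → (Fin n → ℝ) → ℝ := fun θ D x =>
    if i ∈ D then θ * (|x i| - absMean P i) - θ ^ 2 / 8 else 0 with hφ
  have hφsum : ∀ θ ω, ∑ u ∈ Finset.Icc 1 (t - 1), φ θ (A u ω) (X u ω)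
      = θ * (counter (fun t => A t ω) (t - 1) i
          * (empAbsMean (fun t => A t ω) (fun t => X t ω) (t - 1) i - absMean P i))
        - counter (fun t => A t ω) (t - 1) i * (θ ^ 2 / 8) := fun θ ω =>
    sum_mem_sub_eq (fun t => A t ω) (fun t i => |X t ω i|) (t - 1) i θ (absMean P i) (θ ^ 2 / 8)
  -- The optimal Hoeffding exponent depends on the random counter, so all its values `k < t` enter
  -- the union bound. At radius `r` and `θ = 4 r`, the exponent is at least `4 k r² - 2 k r² = 3 log
  -- t`.
  set θ : ℕ → ℝ := fun k => 4 * √(1.5 * Real.log t / (k : ℝ)) with hθ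
  set E : ℝ → Set Ω := fun θ =>
    {ω | 3 * Real.log t ≤ ∑ u ∈ Finset.Icc 1 (t - 1), φ θ (A u ω) (X u ω)} with hE
  have hQE : ∀ θ, Q (E θ) ≤ ENNReal.ofReal (1 / (t : ℝ) ^ 3) := by
    intro θ
    rw [← exp_neg_three_mul_log (by omega : 1 ≤ t)]
    refine h.measure_le_sum_le (fun D => ?_) (fun D => ?_) _ _
    · simp only [hφ]
      split_ifs
      · exact (((measurable_pi_apply i).abs.sub_const _).const_mul _).sub_const _
      · exact measurable_const
    · simp only [hφ]
      split_ifs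
      · exact lintegral_exp_abs_le_one hb i θ
      · simp
  have hsub : {ω | 1 ≤ counter (fun t => A t ω) (t - 1) i ∧
      √(1.5 * Real.log t / (counter (fun t => A t ω) (t - 1) i : ℝ))
        < |empAbsMean (fun t => A t ω) (fun t => X t ω) (t - 1) i - absMean P i|}
      ⊆ ⋃ k ∈ Finset.range t, (E (θ k) ∪ E (-θ k)) := by
    rintro ω ⟨h1, h2⟩
    set N := counter (fun t => A t ω) (t - 1) i with hN
    have hN0 : (0 : ℝ) < N := by exact_mod_cast h1
    have hNt : N < t := lt_of_le_of_lt (counter_le _ _ _) (by omega)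
    simp only [Set.mem_iUnion, Finset.mem_range]
    refine ⟨N, hNt, ?_⟩
    set r := √(1.5 * Real.log t / (N : ℝ)) with hr
    have hr2 : N * r ^ 2 = 1.5 * Real.log t := by
      rw [hr, Real.sq_sqrt (by positivity)]; field_simp
    have hr0 : 0 ≤ r := Real.sqrt_nonneg _
    have hNr : 0 ≤ N * r := by positivity
    have hθN : θ N = 4 * r := rfl
    rcases lt_abs.1 h2 with h3 | h3
    · left
      simp only [hE, Set.mem_ofPred_eq]
      rw [hφsum, hθN]
      nlinarith [mul_le_mul_of_nonneg_left h3.le hNr]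
    · right
      simp only [hE, Set.mem_ofPred_eq]
      rw [hφsum, hθN]
      nlinarith [mul_le_mul_of_nonneg_left h3.le hNr]
  refine (measure_mono hsub).trans ((measure_biUnion_finset_le _ _).trans ?_)
  refine (Finset.sum_le_sum (g := fun _ => ENNReal.ofReal (2 * (1 / (t : ℝ) ^ 3)))
    fun k _ => (measure_union_le _ _).trans ?_).trans ?_
  · rw [two_mul, ENNReal.ofReal_add (by positivity) (by positivity)]
    exact add_le_add (hQE _) (hQE _)
  · rw [Finset.sum_const, nsmul_eq_mul, Finset.card_range, ENNReal.ofReal_mul (by positivity)]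
    simp

/-- The polylogarithmic number of exponent choices may cost one factor `t`: `t * t⁻³` is still
summable. -/
theorem exists_two_mul_clog_add_three_pow_le (n : ℕ) :
    ∃ C : ℝ, 0 ≤ C ∧ ∀ t : ℕ, 1 ≤ t → (2 * (Nat.clog 2 t : ℝ) + 3) ^ n ≤ C * t := by
  have hlim := tendsto_pow_const_div_const_pow_of_one_lt n (by norm_num : (1 : ℝ) < 2)
  obtain ⟨D, hD⟩ := hlim.bddAbove_range
  have hD' : ∀ k : ℕ, (k : ℝ) ^ n ≤ D * 2 ^ k := by
    intro k
    have := hD (Set.mem_range_self k)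
    rwa [div_le_iff₀ (by positivity)] at this
  have hD0 : 0 ≤ D := by
    have := hD' 1
    simp at this; linarith
  refine ⟨3 ^ n * (D * 4), by positivity, fun t ht => ?_⟩
  have h1 : (2 : ℝ) ^ (Nat.clog 2 t + 1) ≤ 4 * t := by
    rcases ht.eq_or_lt with rfl | ht
    · norm_num
    · have := Nat.pow_pred_clog_lt_self (by norm_num : 1 < 2) ht
      have hc := Nat.clog_pos (by norm_num : 1 < 2) ht
      have e : Nat.clog 2 t + 1 = (Nat.clog 2 t).pred + 2 := by
        rw [Nat.pred_eq_sub_one]; omega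
      rw [e, pow_add]
      have : (2 : ℝ) ^ (Nat.clog 2 t).pred ≤ t := by exact_mod_cast this.le
      linarith
  calc (2 * (Nat.clog 2 t : ℝ) + 3) ^ n ≤ (3 * ((Nat.clog 2 t + 1 : ℕ) : ℝ)) ^ n := by
        gcongr; push_cast; linarith [(Nat.cast_nonneg (Nat.clog 2 t) : (0 : ℝ) ≤ _)]
    _ = 3 ^ n * ((Nat.clog 2 t + 1 : ℕ) : ℝ) ^ n := by rw [mul_pow]
    _ ≤ 3 ^ n * (D * 2 ^ (Nat.clog 2 t + 1)) := by gcongr; exact hD' _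
    _ ≤ 3 ^ n * (D * (4 * t)) := by gcongr
    _ = 3 ^ n * (D * 4) * t := by ring

theorem IsInteraction.exists_measure_not_goodRound_le [IsProbabilityMeasure P]
    [IsProbabilityMeasure Q] (h : IsInteraction P Q ℱ X A) {𝒜 : Finset (Finset (Fin n))} {s : ℝ}
    (hb : ∀ᵐ x ∂P, (∀ i, |x i| ≤ 1) ∧ ∑ i, |x i| ≤ s) (hS : 0 < min s (maxSize 𝒜 : ℝ)) :
    ∃ C : ℝ, 0 ≤ C ∧ ∀ t, 2 ≤ t →
      Q {ω | ¬ GoodRound P 𝒜 s (fun t => A t ω) (fun t => X t ω) t}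
        ≤ ENNReal.ofReal (C * (1 / (t : ℝ) ^ 2)) := by
  obtain ⟨D, hD0, hD⟩ := exists_two_mul_clog_add_three_pow_le n
  refine ⟨𝒜.card * D + n * 2, by positivity, fun t ht => ?_⟩
  have ht0 : (0 : ℝ) < t := by exact_mod_cast (by omega : 0 < t)
  have hsub : {ω | ¬ GoodRound P 𝒜 s (fun t => A t ω) (fun t => X t ω) t}
      ⊆ (⋃ B ∈ 𝒜, {ω | 8 * Real.log t + maxSize 𝒜 < ∑ i ∈ B, confTerm (maxSize 𝒜)
          (min s (maxSize 𝒜)) (counter (fun t => A t ω) (t - 1) i) (absMean P i)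
          (empMean (fun t => A t ω) (fun t => X t ω) (t - 1) i - meanVec P i)})
        ∪ ⋃ i ∈ (Finset.univ : Finset (Fin n)), {ω | 1 ≤ counter (fun t => A t ω) (t - 1) i ∧
          √(1.5 * Real.log t / (counter (fun t => A t ω) (t - 1) i : ℝ))
            < |empAbsMean (fun t => A t ω) (fun t => X t ω) (t - 1) i - absMean P i|} := by
    intro ω hω
    by_contra hcon
    apply hω
    simp only [Set.mem_union, Set.mem_iUnion, Set.mem_ofPred_eq, not_or, not_exists, not_and,
      not_lt] at hcon
    exact ⟨fun B hB => hcon.1 B hB, fun i hi => hcon.2 i (Finset.mem_univ i) hi⟩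
  refine (measure_mono hsub).trans ((measure_union_le _ _).trans ?_)
  rw [add_mul, ENNReal.ofReal_add (by positivity) (by positivity)]
  refine add_le_add ?_ ?_
  · refine (measure_biUnion_finset_le _ _).trans ((Finset.sum_le_sum fun B hB =>
      h.measure_confTerm_lt hb hS hB ht).trans ?_)
    rw [Finset.sum_const, nsmul_eq_mul, ← ENNReal.ofReal_natCast,
      ← ENNReal.ofReal_mul (by positivity)]
    apply ENNReal.ofReal_le_ofReal
    calc _ ≤ (𝒜.card : ℝ) * (D * t * (1 / (t : ℝ) ^ 3)) := by
          gcongr; exact hD t (by omega)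
      _ = _ := by field_simp
  · refine (measure_biUnion_finset_le _ _).trans ((Finset.sum_le_sum fun i _ =>
      h.measure_empAbsMean_dev_lt (hb.mono fun x hx => hx.1) i ht).trans ?_)
    rw [Finset.sum_const, nsmul_eq_mul, ← ENNReal.ofReal_natCast,
      ← ENNReal.ofReal_mul (by positivity)]
    apply ENNReal.ofReal_le_ofReal
    rw [Finset.card_univ, Fintype.card_fin]
    apply le_of_eq
    field_simp

end concentration

/-! ### Decomposition of the regret -/

section regret

variable {n : ℕ} {Ω : Type*} [mΩ : MeasurableSpace Ω] {P : Measure (Fin n → ℝ)} {Q : Measure Ω}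
  {ℱ : Filtration ℕ mΩ} {X : ℕ → Ω → Fin n → ℝ} {A : ℕ → Ω → Finset (Fin n)}

/-- The action is decided before the outcome, so the outcome may be averaged out with the action
frozen. -/
theorem IsInteraction.integrable_and_integral_comp [IsProbabilityMeasure Q]
    (h : IsInteraction P Q ℱ X A) {ψ : Finset (Fin n) → (Fin n → ℝ) → ℝ}
    (hψ : ∀ B, Measurable (ψ B)) (hψi : ∀ B, Integrable (ψ B) P) {t : ℕ} (ht : 1 ≤ t) :
    Integrable (fun ω => ψ (A t ω) (X t ω)) Q ∧ Integrable (fun ω => ∫ x, ψ (A t ω) x ∂P) Q ∧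
      ∫ ω, ψ (A t ω) (X t ω) ∂Q = ∫ ω, (∫ x, ψ (A t ω) x ∂P) ∂Q := by
  have hX := h.measurable_outcome ht
  have hsel : ∀ f : Finset (Fin n) → Ω → ℝ, (fun ω => f (A t ω) ω)
      = fun ω => ∑ B, {ω | A t ω = B}.indicator (fun _ => (1 : ℝ)) ω * f B ω := by
    intro f; ext ω; simp [Set.indicator_apply]
  have hset : ∀ B, MeasurableSet {ω | A t ω = B} := fun B =>
    ℱ.le _ _ (h.action_measurable t ht B)
  have hint : ∀ B, Integrable (fun ω => ψ B (X t ω)) Q := by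
    intro B
    have := hψi B
    rw [← h.outcome_law t ht] at this
    exact this.comp_measurable hX
  have hind : ∀ B, Integrable ({ω | A t ω = B}.indicator fun _ => (1 : ℝ)) Q := fun B =>
    (integrable_const _).indicator (hset B)
  have hprod : ∀ B, Integrable
      (fun ω => {ω | A t ω = B}.indicator (fun _ => (1 : ℝ)) ω * ψ B (X t ω)) Q := by
    intro B
    have e : (fun ω => {ω | A t ω = B}.indicator (fun _ => (1 : ℝ)) ω * ψ B (X t ω))
        = {ω | A t ω = B}.indicator fun ω => ψ B (X t ω) := by
      ext ω; simp [Set.indicator_apply]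
    rw [e]
    exact (hint B).indicator (hset B)
  have hmul : ∀ B, ∫ ω, {ω | A t ω = B}.indicator (fun _ => (1 : ℝ)) ω * ψ B (X t ω) ∂Q
      = ∫ ω, {ω | A t ω = B}.indicator (fun _ => (1 : ℝ)) ω * ∫ x, ψ B x ∂P ∂Q := by
    intro B
    have hindep : IndepFun ({ω | A t ω = B}.indicator fun _ => (1 : ℝ))
        (fun ω => ψ B (X t ω)) Q := by
      rw [IndepFun_iff_Indep]
      refine indep_of_indep_of_le_left (indep_of_indep_of_le_right (h.outcome_indep t ht).symm ?_) ?_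
      · exact ((hψ B).comp (comap_measurable (X t))).comap_le
      · exact (measurable_const.indicator (h.action_measurable t ht B)).comap_le
    rw [hindep.integral_fun_mul_eq_mul_integral (hind B).aestronglyMeasurable
      (hint B).aestronglyMeasurable, integral_mul_const]
    congr 1
    rw [← integral_map hX.aemeasurable (hψ B).aestronglyMeasurable, h.outcome_law t ht]
  have e1 := hsel fun B ω => ψ B (X t ω)
  have e2 := hsel fun B _ => ∫ x, ψ B x ∂P
  have hi2 : ∀ B, Integrable
      (fun ω => {ω | A t ω = B}.indicator (fun _ => (1 : ℝ)) ω * ∫ x, ψ B x ∂P) Q := fun B =>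
    (hind B).mul_const _
  refine ⟨?_, ?_, ?_⟩
  · rw [e1]
    exact integrable_finsetSum _ fun B _ => hprod B
  · rw [e2]
    exact integrable_finsetSum _ fun B _ => hi2 B
  · rw [e1, e2, integral_finsetSum _ fun B _ => hprod B, integral_finsetSum _ fun B _ => hi2 B]
    exact Finset.sum_congr rfl fun B _ => hmul B

theorem IsInteraction.regret_eq [IsProbabilityMeasure P] [IsProbabilityMeasure Q]
    (h : IsInteraction P Q ℱ X A) (hb : ∀ᵐ x ∂P, ∀ i, |x i| ≤ 1) (Astar : Finset (Fin n)) (T : ℕ) :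
    Integrable (fun ω => ∑ t ∈ Finset.Icc 1 T, gap P Astar (A t ω)) Q ∧
    regret Q Astar X A T = ∫ ω, ∑ t ∈ Finset.Icc 1 T, gap P Astar (A t ω) ∂Q := by
  have htot : ∀ B : Finset (Fin n), Integrable (fun x => total B x) P := fun B =>
    integrable_finsetSum _ fun i _ => integrable_coord hb i
  have htotint : ∀ B : Finset (Fin n), ∫ x, total B x ∂P = total B (meanVec P) := fun B =>
    integral_finsetSum _ fun i _ => integrable_coord hb i
  have htotm : ∀ B : Finset (Fin n), Measurable fun x : Fin n → ℝ => total B x := fun B =>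
    Finset.measurable_fun_sum _ fun i _ => measurable_pi_apply i
  have hgap : ∀ B, ∫ x, (total Astar x - total B x) ∂P = gap P Astar B := by
    intro B
    rw [integral_sub (htot _) (htot _), htotint, htotint, gap]
  have key := fun t (ht : 1 ≤ t) => h.integrable_and_integral_comp
    (ψ := fun B x => total Astar x - total B x) (fun B => (htotm _).sub (htotm _))
    (fun B => (htot _).sub (htot _)) ht
  simp only [hgap] at key
  refine ⟨integrable_finsetSum _ fun t ht => (key t (Finset.mem_Icc.1 ht).1).2.1, ?_⟩
  unfold regret
  rw [integral_finsetSum _ fun t ht => (key t (Finset.mem_Icc.1 ht).1).1,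
    integral_finsetSum _ fun t ht => (key t (Finset.mem_Icc.1 ht).1).2.1]
  exact Finset.sum_congr rfl fun t ht => (key t (Finset.mem_Icc.1 ht).1).2.2

end regret

/-! ### Charging the gaps to the arms -/

section charge

variable {n : ℕ}

/-- The total charge of arm `i` when its counter is `k`. -/
def armCharge (P : Measure (Fin n → ℝ)) (m S Δ Δmax L τ : ℝ) (i : Fin n) (k : ℕ) : ℝ :=
  chargeMin (54 * L * m) Δ Δmax k + chargeSq Δ m (648 * L * (absMean P i * S) / k)
    + chargeSq Δ m (Δ ^ 2 * (τ * √τ) / (k * √(k : ℝ)))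

theorem armCharge_nonneg (P : Measure (Fin n → ℝ)) {m S Δ Δmax L τ : ℝ} (hm : 0 ≤ m) (hS : 0 ≤ S)
    (hΔ : 0 < Δ) (hM : 0 ≤ Δmax) (hL : 0 ≤ L) (hτ : 0 ≤ τ) (i : Fin n) (k : ℕ) :
    0 ≤ armCharge P m S Δ Δmax L τ i k := by
  have := absMean_nonneg P i
  have h1 := chargeMin_nonneg (Δ := Δ) (by positivity : 0 ≤ 54 * L * m) hM k
  have h2 := chargeSq_nonneg (M := m) hΔ
    (by positivity : 0 ≤ 648 * L * (absMean P i * S) / (k : ℝ))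
  have h3 := chargeSq_nonneg (M := m) hΔ
    (by positivity : 0 ≤ Δ ^ 2 * (τ * √τ) / (k * √(k : ℝ)))
  unfold armCharge; linarith

theorem sum_armCharge_le (P : Measure (Fin n → ℝ)) {m S Δ Δmax L τ : ℝ} (hm : 1 ≤ m) (hS : 0 ≤ S)
    (hΔ : 0 < Δ) (hM : Δ ≤ Δmax) (hL : 0 ≤ L) (hτ : 0 < τ) (T : ℕ) :
    ∑ i, ∑ k ∈ Finset.range T, armCharge P m S Δ Δmax L τ i k
      ≤ n * (54 * L * m + 2 * (54 * L * m) * Real.log (2 * (Δmax / Δ)))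
        + 648 * L * (∑ i, absMean P i * S) / Δ * (6 + 4 * Real.log (4 * m))
        + n * (28 * (Δ * τ)) := by
  have h : ∀ i, ∑ k ∈ Finset.range T, armCharge P m S Δ Δmax L τ i k
      ≤ (54 * L * m + 2 * (54 * L * m) * Real.log (2 * (Δmax / Δ)))
        + 648 * L * (absMean P i * S) / Δ * (6 + 4 * Real.log (4 * m)) + 28 * (Δ * τ) := by
    intro i
    have := absMean_nonneg P i
    simp only [armCharge, Finset.sum_add_distrib]
    exact add_le_add (add_le_add (sum_chargeMin_le (by positivity) hΔ hM T)
      (sum_chargeSq_div_le (by positivity) hΔ hm T)) (sum_chargeSq_div_mul_sqrt_le hτ hΔ T)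
  refine (Finset.sum_le_sum fun i _ => h i).trans (le_of_eq ?_)
  simp only [Finset.sum_add_distrib, Finset.sum_const, Finset.card_univ, Fintype.card_fin,
    nsmul_eq_mul, ← Finset.sum_mul, ← Finset.sum_div, ← Finset.mul_sum]
  ring

theorem GoodRound.gap_le_sum_armCharge {P : Measure (Fin n → ℝ)} {𝒜 : Finset (Finset (Fin n))}
    {s : ℝ} {a : ℕ → Finset (Fin n)} {x : ℕ → Fin n → ℝ} {t : ℕ} {Astar : Finset (Fin n)}
    {L τ Δ Δmax : ℝ}
    (hgood : GoodRound P 𝒜 s a x t) (hS : 0 < min s (maxSize 𝒜 : ℝ))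
    (halg : IsSparseESCBC 𝒜 s a x) (hA : Astar ∈ 𝒜) (hnt : n < t) (ht : 3 ≤ t)
    (hL : Real.log t ≤ L)
    (hfL : 8 * (Real.log t + Real.log (Real.log t)) + 4 * Real.exp 1 * maxSize 𝒜 ≤ 9 * L)
    (hΔ : IsLeast (posGaps P 𝒜 Astar) Δ) (hΔmax : IsGreatest (posGaps P 𝒜 Astar) Δmax)
    (hτ : 0 ≤ τ) (hτL : Δ ^ 2 * (τ * √τ) = 1728 * (L * √L) * min s (maxSize 𝒜 : ℝ)) :
    gap P Astar (a t) ≤ ∑ i ∈ a t, armCharge P (maxSize 𝒜) (min s (maxSize 𝒜)) Δ Δmax L τ i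
      (counter a (t - 1) i) := by
  obtain ⟨hat, htri⟩ := hgood.gap_trichotomy hS halg hA hnt ht hL hfL
  have hΔ0 : 0 < Δ := hΔ.1.1
  have hM0 : 0 < Δmax := hΔmax.1.1
  have hL0 : 0 ≤ L := (Real.log_nonneg (by exact_mod_cast (by omega : 1 ≤ t))).trans hL
  set m : ℝ := (maxSize 𝒜 : ℝ) with hm
  have hm0 : 0 < m := hS.trans_le (min_le_right _ _)
  have hm1 : 1 ≤ m := by
    rw [hm] at hm0 ⊢; exact_mod_cast (by exact_mod_cast hm0 : 0 < maxSize 𝒜)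
  have hcard : ((a t).card : ℝ) ≤ m := by rw [hm]; exact_mod_cast card_le_maxSize hat
  set N := counter a (t - 1) with hN
  have hb : ∀ i, 0 ≤ 648 * L * (absMean P i * min s m) / (N i : ℝ) := fun i => by
    have := absMean_nonneg P i; positivity
  have hc : ∀ i, 0 ≤ Δ ^ 2 * (τ * √τ) / (N i * √(N i : ℝ)) := fun i => by positivity
  have n1 : ∀ i, 0 ≤ chargeMin (54 * L * m) Δ Δmax (N i) := fun i =>
    chargeMin_nonneg (by positivity) hM0.le _
  have n2 := fun i => chargeSq_nonneg (M := m) hΔ0 (hb i)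
  have n3 := fun i => chargeSq_nonneg (M := m) hΔ0 (hc i)
  rcases le_or_gt (gap P Astar (a t)) 0 with hneg | hpos
  · refine hneg.trans (Finset.sum_nonneg fun i _ => ?_)
    exact armCharge_nonneg P hm0.le hS.le hΔ0 hM0.le hL0 hτ i _
  have hmem : gap P Astar (a t) ∈ posGaps P 𝒜 Astar := ⟨hpos, a t, hat, rfl⟩
  have hle := hΔ.2 hmem
  have hge := hΔmax.2 hmem
  rcases htri hpos with ⟨j, hj, h1⟩ | h1 | h1
  · refine le_trans ?_ (Finset.single_le_sum (fun i _ =>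
      armCharge_nonneg P hm0.le hS.le hΔ0 hM0.le hL0 hτ i _) hj)
    have : gap P Astar (a t) ≤ chargeMin (54 * L * m) Δ Δmax (N j) := by
      unfold chargeMin
      rw [if_pos]
      · exact le_min hge h1
      · rcases Nat.eq_zero_or_pos (N j) with h0 | h0
        · rw [h0]; simp; positivity
        · have h0' : (0 : ℝ) < N j := by exact_mod_cast h0
          rw [le_div_iff₀ hΔ0]
          rw [le_div_iff₀ h0'] at h1
          nlinarith
    unfold armCharge
    linarith [n2 j, n3 j]
  · refine (le_sum_chargeSq hΔ0 hle (fun i _ => hb i) hcard hm1 h1).trans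
      (Finset.sum_le_sum fun i _ => ?_)
    unfold armCharge
    linarith [n1 i, n3 i]
  · rw [← hτL] at h1
    refine (le_sum_chargeSq hΔ0 hle (fun i _ => hc i) hcard hm1 h1).trans
      (Finset.sum_le_sum fun i _ => ?_)
    unfold armCharge
    linarith [n1 i, n2 i]

end charge

/-! ### The regret bound -/

section bound

variable {n : ℕ} {Ω : Type*} [mΩ : MeasurableSpace Ω] {P : Measure (Fin n → ℝ)} {Q : Measure Ω}
  {ℱ : Filtration ℕ mΩ} {X : ℕ → Ω → Fin n → ℝ} {A : ℕ → Ω → Finset (Fin n)}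

theorem IsInteraction.exists_regret_le [IsProbabilityMeasure P] [IsProbabilityMeasure Q]
    (h : IsInteraction P Q ℱ X A) {𝒜 : Finset (Finset (Fin n))} {s Δ Δmax : ℝ}
    {Astar : Finset (Fin n)}
    (halg : ∀ ω, IsSparseESCBC 𝒜 s (fun t => A t ω) (fun t => X t ω))
    (hb : ∀ᵐ x ∂P, (∀ i, |x i| ≤ 1) ∧ ∑ i, |x i| ≤ s) (hS : 0 < min s (maxSize 𝒜 : ℝ))
    (hA : Astar ∈ 𝒜) (hΔ : IsLeast (posGaps P 𝒜 Astar) Δ)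
    (hΔmax : IsGreatest (posGaps P 𝒜 Astar) Δmax) :
    ∃ K : ℝ, ∀ (T : ℕ) (τ : ℝ), 3 ≤ T →
      8 * (Real.log T + Real.log (Real.log T)) + 4 * Real.exp 1 * maxSize 𝒜 ≤ 9 * Real.log T →
      0 ≤ τ →
      Δ ^ 2 * (τ * √τ) = 1728 * (Real.log T * √(Real.log T)) * min s (maxSize 𝒜 : ℝ) →
      regret Q Astar X A T ≤ K + ∑ i, ∑ k ∈ Finset.range T,
        armCharge P (maxSize 𝒜) (min s (maxSize 𝒜)) Δ Δmax (Real.log T) τ i k := by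
  obtain ⟨C, hC0, hC⟩ := h.exists_measure_not_goodRound_le hb hS
  set bad : ℕ → Set Ω := fun t =>
    -- A measurable hull of the same measure spares a proof that this event is measurable.
    toMeasurable Q {ω | ¬ GoodRound P 𝒜 s (fun t => A t ω) (fun t => X t ω) t} with hbad
  have hbm : ∀ t, MeasurableSet (bad t) := fun t => measurableSet_toMeasurable _ _
  have hbQ : ∀ t, 2 ≤ t → Q.real (bad t) ≤ C * (1 / (t : ℝ) ^ 2) := by
    intro t ht
    refine ENNReal.toReal_le_of_le_ofReal (by positivity) ?_
    rw [hbad, measure_toMeasurable]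
    exact hC t ht
  set M := ∑ B : Finset (Fin n), |gap P Astar B| with hM
  have hgM : ∀ B, gap P Astar B ≤ M := fun B => (le_abs_self _).trans
    (Finset.single_le_sum (f := fun B => |gap P Astar B|) (fun _ _ => abs_nonneg _)
      (Finset.mem_univ B))
  have hM0 : 0 ≤ M := Finset.sum_nonneg fun _ _ => abs_nonneg _
  -- Past `n` the initialization is over, and past `2` the iterated logarithm is nonnegative.
  -- Earlier rounds are paid at the crude rate `M`.
  set n' := max n 2 with hn'
  have hsumm : Summable fun t : ℕ => 1 / (t : ℝ) ^ 2 :=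
    Real.summable_one_div_nat_pow.2 (by norm_num)
  refine ⟨n' * M + M * (C * ∑' t : ℕ, 1 / (t : ℝ) ^ 2), fun T τ hT hfL hτ hτL => ?_⟩
  set L := Real.log T with hL
  set D := ∑ i, ∑ k ∈ Finset.range T,
    armCharge P (maxSize 𝒜) (min s (maxSize 𝒜)) Δ Δmax L τ i k with hD
  have hL0 : 0 ≤ L := Real.log_nonneg (by exact_mod_cast (by omega : 1 ≤ T))
  have hnn : ∀ i k, 0 ≤ armCharge P (maxSize 𝒜) (min s (maxSize 𝒜)) Δ Δmax L τ i k := fun i k =>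
    armCharge_nonneg P (Nat.cast_nonneg _) hS.le hΔ.1.1 hΔmax.1.1.le hL0 hτ i k
  obtain ⟨hint, hreg⟩ := h.regret_eq (hb.mono fun x hx => hx.1) Astar T
  have hpt : ∀ ω, ∑ t ∈ Finset.Icc 1 T, gap P Astar (A t ω)
      ≤ n' * M + D + ∑ t ∈ Finset.Ioc n' T, (bad t).indicator (fun _ => M) ω := by
    intro ω
    have hround : ∀ t ∈ Finset.Icc 1 T, gap P Astar (A t ω)
        ≤ (if t ≤ n' then M else 0) + (if n' < t then (bad t).indicator (fun _ => M) ω else 0)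
          + ∑ i ∈ A t ω, armCharge P (maxSize 𝒜) (min s (maxSize 𝒜)) Δ Δmax L τ i
              (counter (fun t => A t ω) (t - 1) i) := by
      intro t ht
      rw [Finset.mem_Icc] at ht
      have hch : 0 ≤ ∑ i ∈ A t ω, armCharge P (maxSize 𝒜) (min s (maxSize 𝒜)) Δ Δmax L τ i
              (counter (fun t => A t ω) (t - 1) i) := Finset.sum_nonneg fun i _ => hnn i _
      rcases le_or_gt t n' with htn | htn
      · rw [if_pos htn, if_neg (not_lt.2 htn)]
        linarith [hgM (A t ω)]
      · rw [if_neg (not_le.2 htn), if_pos htn]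
        have hnt : n < t := lt_of_le_of_lt (le_max_left _ _) htn
        have ht3 : 3 ≤ t := lt_of_le_of_lt (le_max_right n 2) htn
        by_cases hg : GoodRound P 𝒜 s (fun t => A t ω) (fun t => X t ω) t
        · have h0 : 0 ≤ (bad t).indicator (fun _ => M) ω := Set.indicator_nonneg (fun _ _ => hM0) ω
          have ht1 : (1 : ℝ) < t := by exact_mod_cast (by omega : 1 < t)
          have hlt : Real.log t ≤ L := by
            apply Real.log_le_log (by linarith); exact_mod_cast ht.2
          have hlpos : 0 < Real.log t := Real.log_pos ht1
          have hllt : Real.log (Real.log t) ≤ Real.log L := Real.log_le_log hlpos hlt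
          have := hg.gap_le_sum_armCharge hS (halg ω) hA hnt ht3 hlt (by linarith) hΔ hΔmax hτ hτL
          linarith
        · have hmem : ω ∈ bad t := subset_toMeasurable _ _ hg
          rw [Set.indicator_of_mem hmem]
          linarith [hgM (A t ω)]
    refine (Finset.sum_le_sum hround).trans ?_
    rw [Finset.sum_add_distrib, Finset.sum_add_distrib]
    have h1 : ∑ t ∈ Finset.Icc 1 T, (if t ≤ n' then M else 0) ≤ n' * M := by
      rw [← Finset.sum_filter, Finset.sum_const, nsmul_eq_mul]
      gcongr
      have : (Finset.Icc 1 T).filter (fun t => t ≤ n') ⊆ Finset.Icc 1 n' := by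
        intro t ht
        simp only [Finset.mem_filter, Finset.mem_Icc] at ht ⊢
        omega
      simpa using Finset.card_le_card this
    have h2 : ∑ t ∈ Finset.Icc 1 T, (if n' < t then (bad t).indicator (fun _ => M) ω else 0)
        = ∑ t ∈ Finset.Ioc n' T, (bad t).indicator (fun _ => M) ω := by
      rw [← Finset.sum_filter]
      refine Finset.sum_congr ?_ fun _ _ => rfl
      ext t
      simp only [Finset.mem_filter, Finset.mem_Icc, Finset.mem_Ioc]
      omega
    have h3 := sum_sum_counter_le (fun t => A t ω) hnn T
    rw [h2]
    linarith
  have hind : ∀ t, Integrable ((bad t).indicator fun _ => M) Q := fun t =>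
    (integrable_const _).indicator (hbm t)
  rw [hreg]
  refine (integral_mono hint ((integrable_const _).add
    (integrable_finsetSum _ fun t _ => hind t)) hpt).trans ?_
  rw [integral_add' (integrable_const _) (integrable_finsetSum _ fun t _ => hind t),
    integral_finsetSum _ fun t _ => hind t]
  have h4 : ∑ t ∈ Finset.Ioc n' T, ∫ ω, (bad t).indicator (fun _ => M) ω ∂Q
      ≤ M * (C * ∑' t : ℕ, 1 / (t : ℝ) ^ 2) := by
    have : ∀ t ∈ Finset.Ioc n' T, ∫ ω, (bad t).indicator (fun _ => M) ω ∂Q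
        ≤ M * (C * (1 / (t : ℝ) ^ 2)) := by
      intro t ht
      have ht2 : 2 ≤ t := ((le_max_right n 2).trans_lt (Finset.mem_Ioc.1 ht).1).le
      rw [integral_indicator_const _ (hbm t), smul_eq_mul, mul_comm]
      gcongr
      exact hbQ t ht2
    refine (Finset.sum_le_sum this).trans ?_
    rw [← Finset.mul_sum, ← Finset.mul_sum]
    gcongr
    exact hsumm.sum_le_tsum _ fun t _ => by positivity
  have h5 : ∫ _, (n' * M + D) ∂Q = n' * M + D := by simp
  linarith

theorem sum_absMean_le [IsProbabilityMeasure P] {s : ℝ}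
    (hb : ∀ᵐ x ∂P, (∀ i, |x i| ≤ 1) ∧ ∑ i, |x i| ≤ s) : ∑ i, absMean P i ≤ s := by
  have hb1 : ∀ᵐ x ∂P, ∀ i, |x i| ≤ 1 := hb.mono fun x hx => hx.1
  unfold absMean
  rw [← integral_finsetSum _ fun i _ => integrable_abs_coord hb1 i]
  calc ∫ x, ∑ i, |x i| ∂P ≤ ∫ _, s ∂P :=
        integral_mono_ae (integrable_finsetSum _ fun i _ => integrable_abs_coord hb1 i)
          (integrable_const _) (hb.mono fun x hx => hx.2)
    _ = s := by simp

/-- A positive gap excludes a zero mean vector and a family consisting of the empty action only, so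
the final bound is strictly positive and can absorb constants. -/
theorem sum_absMean_pos_and_maxSize_pos {𝒜 : Finset (Finset (Fin n))} {Astar : Finset (Fin n)}
    {d : ℝ} (hA : Astar ∈ 𝒜) (hd : d ∈ posGaps P 𝒜 Astar) :
    0 < ∑ i, absMean P i ∧ 0 < maxSize 𝒜 := by
  obtain ⟨hd0, B, hB, rfl⟩ := hd
  constructor
  · by_contra hcon
    have h0 : ∀ i, absMean P i = 0 := by
      intro i
      have h1 := Finset.single_le_sum (f := fun i => absMean P i)
        (fun i _ => absMean_nonneg P i) (Finset.mem_univ i)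
      have := absMean_nonneg P i
      linarith
    have h1 : ∀ i, meanVec P i = 0 := by
      intro i
      have : |meanVec P i| ≤ absMean P i := abs_integral_le_integral_abs
      rw [h0] at this
      exact abs_nonpos_iff.1 this
    simp [gap, total, h1] at hd0
  · by_contra hcon
    have h0 : ∀ C ∈ 𝒜, C = ∅ := by
      intro C hC
      have := card_le_maxSize hC
      exact Finset.card_eq_zero.1 (by omega)
    rw [h0 B hB, h0 Astar hA] at hd0
    simp [gap] at hd0

end bound

theorem eventually_confidence_level_le (b : ℝ) :
    ∀ᶠ T : ℕ in atTop, 8 * (Real.log T + Real.log (Real.log T)) + b ≤ 9 * Real.log T := by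
  have hlog : Tendsto (fun T : ℕ => Real.log T) atTop atTop :=
    Real.tendsto_log_atTop.comp tendsto_natCast_atTop_atTop
  have h1 := hlog.eventually (Real.isLittleO_log_id_atTop.bound (by norm_num : (0 : ℝ) < 1 / 16))
  filter_upwards [h1, hlog.eventually_ge_atTop (2 * b), hlog.eventually_ge_atTop 0] with T h1 h2 h3
  rw [Real.norm_eq_abs, Real.norm_eq_abs, id, abs_of_nonneg h3] at h1
  have := (abs_le.1 h1).2
  linarith

/-- The charges of all arms, bounded by means of the smallness assumption on the gap. -/
theorem mul_sum_armCharge_le {n : ℕ} {P : Measure (Fin n → ℝ)} {c m S Δ Δmax L r : ℝ} (hc : 0 < c)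
    (hn : 0 < n) (hm : 1 ≤ m) (hS : 0 < S) (hΔ : 0 < Δ) (hM : Δ ≤ Δmax) (hL : 0 < L) (hr : 0 < r)
    (h1 : r ≤ c * Real.log (m + 1) * ∑ i, absMean P i * S / n)
    (h2 : m * Δ + m * Δ * Real.log (Δmax / Δ)
      ≤ c * Real.log (m + 1) * ∑ i, absMean P i * S / n) (T : ℕ) :
    Δ * ∑ i, ∑ k ∈ Finset.range T, armCharge P m S Δ Δmax L (144 * L * r / Δ ^ 2) i k
      ≤ L * ((20412 + 6500 * c) * Real.log (m + 1) ^ 2 * ∑ i, absMean P i * S) := by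
  have hn0 : (0 : ℝ) < n := by exact_mod_cast hn
  have hW0 : 0 ≤ ∑ i, absMean P i * S :=
    Finset.sum_nonneg fun i _ => mul_nonneg (absMean_nonneg P i) hS.le
  rw [← Finset.sum_div] at h1 h2
  refine (mul_le_mul_of_nonneg_left (sum_armCharge_le P (τ := 144 * L * r / Δ ^ 2) hm hS.le hΔ hM
    hL.le (by positivity) T) hΔ.le).trans ?_
  set W := ∑ i, absMean P i * S with hW
  set l := Real.log (m + 1) with hl
  have hl1 : Real.log 2 ≤ l := Real.log_le_log (by norm_num) (by linarith)
  have hl2 : 0.6931 ≤ l := by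
    linarith [Real.log_two_gt_d9]
  have hlog2 : Real.log 2 ≤ 0.6932 := by linarith [Real.log_two_lt_d9]
  have hlM : 0 ≤ Real.log (Δmax / Δ) := Real.log_nonneg ((one_le_div hΔ).2 hM)
  have e1 : Real.log (2 * (Δmax / Δ)) = Real.log 2 + Real.log (Δmax / Δ) :=
    Real.log_mul (by norm_num) (by have := hΔ.trans_le hM; positivity)
  have e2 : Real.log (4 * m) ≤ 3 * l := by
    have h4 : Real.log 4 = 2 * Real.log 2 := by
      rw [show (4 : ℝ) = 2 ^ 2 by norm_num, Real.log_pow]; norm_num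
    have : Real.log m ≤ l := Real.log_le_log (by linarith) (by linarith)
    rw [Real.log_mul (by norm_num) (by linarith), h4]
    linarith
  have h1' : n * r ≤ c * l * W := by
    have := mul_le_mul_of_nonneg_left h1 hn0.le
    calc n * r ≤ n * (c * l * (W / n)) := this
      _ = c * l * W := by field_simp
  have h2' : n * (m * Δ + m * Δ * Real.log (Δmax / Δ)) ≤ c * l * W := by
    have := mul_le_mul_of_nonneg_left h2 hn0.le
    calc _ ≤ n * (c * l * (W / n)) := this
      _ = c * l * W := by field_simp
  -- Here the second logarithm is introduced, from `1 / log 2 < 3 / 2`.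
  have hlW : l * W ≤ 3 / 2 * (l ^ 2 * W) := by nlinarith [mul_nonneg (by linarith : 0 ≤ l) hW0]
  have t1 : Δ * (n * (54 * L * m + 2 * (54 * L * m) * Real.log (2 * (Δmax / Δ))))
      ≤ L * (162 * (c * l * W)) := by
    have hmΔ : 0 ≤ n * (m * Δ) := by positivity
    have : n * (m * Δ) * (1 + 2 * Real.log (2 * (Δmax / Δ)))
        ≤ 3 * (n * (m * Δ + m * Δ * Real.log (Δmax / Δ))) := by
      rw [e1]
      nlinarith [mul_nonneg hmΔ hlM, mul_le_mul_of_nonneg_left hlog2 hmΔ]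
    calc _ = L * (54 * (n * (m * Δ) * (1 + 2 * Real.log (2 * (Δmax / Δ))))) := by ring
      _ ≤ L * (54 * (3 * (n * (m * Δ + m * Δ * Real.log (Δmax / Δ))))) := by gcongr
      _ ≤ L * (54 * (3 * (c * l * W))) := by gcongr
      _ = _ := by ring
  have t2 : Δ * (648 * L * W / Δ * (6 + 4 * Real.log (4 * m))) ≤ L * (13608 * (l * W)) := by
    calc _ = L * (648 * W * (6 + 4 * Real.log (4 * m))) := by field_simp
      _ ≤ L * (648 * W * (21 * l)) := by gcongr; linarith
      _ = _ := by ring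
  have t3 : Δ * (n * (28 * (Δ * (144 * L * r / Δ ^ 2)))) ≤ L * (4032 * (c * l * W)) := by
    calc _ = L * (4032 * (n * r)) := by field_simp; norm_num
      _ ≤ _ := by gcongr
  have t4 : L * (162 * (c * l * W)) + L * (13608 * (l * W)) + L * (4032 * (c * l * W))
      = L * ((13608 + 4194 * c) * (l * W)) := by ring
  have t5 : (13608 + 4194 * c) * (l * W) ≤ (20412 + 6500 * c) * l ^ 2 * W := by
    have := mul_le_mul_of_nonneg_left hlW (by positivity : 0 ≤ 13608 + 4194 * c)
    have : 0 ≤ c * (l ^ 2 * W) := by positivity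
    linarith
  have t6 := mul_le_mul_of_nonneg_left t5 hL.le
  rw [mul_add, mul_add]
  linarith

end SemiBandit

end

theorem corollary1 :
    ∀ c : ℝ, 0 < c → ∃ c' : ℝ, 0 < c' ∧
      ∀ (n : ℕ) (𝒜 : Finset (Finset (Fin n))) (s : ℝ)
        (P : Measure (Fin n → ℝ)) [IsProbabilityMeasure P]
        (Ω : Type*) [mΩ : MeasurableSpace Ω] (Q : Measure Ω) [IsProbabilityMeasure Q]
        (ℱ : Filtration ℕ mΩ) (X : ℕ → Ω → Fin n → ℝ) (A : ℕ → Ω → Finset (Fin n))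
        (Astar : Finset (Fin n)) (Δ Δmax : ℝ),
        SemiBandit.IsInteraction P Q ℱ X A →
        (∀ ω, SemiBandit.IsSparseESCBC 𝒜 s (fun t => A t ω) (fun t => X t ω)) →
        (∀ᵐ x ∂P, (∀ i, |x i| ≤ 1) ∧ ∑ i, |x i| ≤ s) →
        SemiBandit.IsOptimal P 𝒜 Astar →
        IsLeast (SemiBandit.posGaps P 𝒜 Astar) Δ →
        IsGreatest (SemiBandit.posGaps P 𝒜 Astar) Δmax →
        max ((Δ * min s (SemiBandit.maxSize 𝒜 : ℝ)) ^ (2 / 3 : ℝ))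
            ((SemiBandit.maxSize 𝒜 : ℝ) * Δ
              + (SemiBandit.maxSize 𝒜 : ℝ) * Δ * Real.log (Δmax / Δ))
          ≤ c * Real.log ((SemiBandit.maxSize 𝒜 : ℝ) + 1)
              * ∑ i, SemiBandit.absMean P i * min s (SemiBandit.maxSize 𝒜 : ℝ) / (n : ℝ) →
        limsup (fun T : ℕ =>
            ((Δ / Real.log (T : ℝ) * SemiBandit.regret Q Astar X A T : ℝ) : EReal)) atTop
          ≤ ((c' * Real.log ((SemiBandit.maxSize 𝒜 : ℝ) + 1) ^ 2
              * ∑ i, SemiBandit.absMean P i * min s (SemiBandit.maxSize 𝒜 : ℝ) : ℝ) : EReal) ∧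
        c' * Real.log ((SemiBandit.maxSize 𝒜 : ℝ) + 1) ^ 2
              * ∑ i, SemiBandit.absMean P i * min s (SemiBandit.maxSize 𝒜 : ℝ)
          ≤ c' * Real.log ((SemiBandit.maxSize 𝒜 : ℝ) + 1) ^ 2
              * (min s (SemiBandit.maxSize 𝒜 : ℝ) * s) := by
  intro c hc
  -- The first two terms come from `mul_sum_armCharge_le`; the last `1` absorbs the cost of
  -- initialization and inaccurate rounds, negligible against `log T`.
  refine ⟨20412 + 6500 * c + 1, by positivity, ?_⟩
  intro n 𝒜 s P _ Ω mΩ Q _ ℱ X A Astar Δ Δmax hint halg hb hopt hΔ hΔmax hsmall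
  have hΔ0 : 0 < Δ := hΔ.1.1
  have hsum := SemiBandit.sum_absMean_le hb
  obtain ⟨hν, hmpos⟩ := SemiBandit.sum_absMean_pos_and_maxSize_pos hopt.1 hΔ.1
  have hn : 0 < n := by
    rcases Nat.eq_zero_or_pos n with rfl | hn
    · simp at hν
    · exact hn
  have hm1 : (1 : ℝ) ≤ SemiBandit.maxSize 𝒜 := by exact_mod_cast hmpos
  have hS : 0 < min s (SemiBandit.maxSize 𝒜 : ℝ) := lt_min (by linarith) (by linarith)
  obtain ⟨K, hK⟩ := hint.exists_regret_le halg hb hS hopt.1 hΔ hΔmax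
  set m : ℝ := (SemiBandit.maxSize 𝒜 : ℝ) with hm
  set S := min s m with hSdef
  set W := ∑ i, SemiBandit.absMean P i * S with hW
  have hWeq : W = (∑ i, SemiBandit.absMean P i) * S := by rw [hW, Finset.sum_mul]
  have hW0 : 0 < W := by rw [hWeq]; positivity
  have hl : 0 < Real.log (m + 1) := Real.log_pos (by linarith)
  constructor
  · have hlog : Tendsto (fun T : ℕ => Real.log T) atTop atTop :=
      Real.tendsto_log_atTop.comp tendsto_natCast_atTop_atTop
    refine limsup_le_of_le (h := ?_)
    filter_upwards [SemiBandit.eventually_confidence_level_le (4 * Real.exp 1 * m),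
      hlog.eventually_ge_atTop (Δ * K / (Real.log (m + 1) ^ 2 * W)), eventually_ge_atTop 3]
      with T h1 h2 h3
    rw [EReal.coe_le_coe_iff]
    set L := Real.log T with hL
    have hL0 : 0 < L := Real.log_pos (by exact_mod_cast (by omega : 1 < T))
    set r := (Δ * S) ^ (2 / 3 : ℝ) with hr
    have hr0 : 0 < r := Real.rpow_pos_of_pos (by positivity) _
    -- This dictates the threshold `τ = 144 L r / Δ²`, with `1728 = 144 * 12`, and is the origin of
    -- the exponent `2 / 3` in the smallness assumption.
    have hrr : r * √r = Δ * S := by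
      rw [Real.sqrt_eq_rpow, hr, ← Real.rpow_mul (by positivity), ← Real.rpow_add (by positivity)]
      norm_num
    have hsqrt : √(144 * L * r / Δ ^ 2) = 12 * √L * √r / Δ := by
      rw [Real.sqrt_div' _ (by positivity), Real.sqrt_sq hΔ0.le,
        Real.sqrt_mul (by positivity), Real.sqrt_mul (by norm_num),
        show (144 : ℝ) = 12 ^ 2 by norm_num, Real.sqrt_sq (by norm_num)]
    have hτL : Δ ^ 2 * ((144 * L * r / Δ ^ 2) * √(144 * L * r / Δ ^ 2))
        = 1728 * (L * √L) * S := by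
      rw [hsqrt]
      have : Δ ^ 2 * ((144 * L * r / Δ ^ 2) * (12 * √L * √r / Δ))
          = 1728 * (L * √L) * (r * √r) / Δ := by field_simp; norm_num
      rw [this, hrr]; field_simp
    have hreg := hK T (144 * L * r / Δ ^ 2) h3 h1 (by positivity) hτL
    have hcharge := SemiBandit.mul_sum_armCharge_le (P := P) hc hn hm1 hS hΔ0 (hΔ.2 hΔmax.1) hL0
      hr0 ((le_max_left _ _).trans hsmall) ((le_max_right _ _).trans hsmall) T
    have hK' : Δ * K ≤ L * (Real.log (m + 1) ^ 2 * W) := (div_le_iff₀ (by positivity)).1 h2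
    have hmain := mul_le_mul_of_nonneg_left hreg hΔ0.le
    rw [div_mul_eq_mul_div, div_le_iff₀ hL0]
    rw [mul_add] at hmain
    linarith
  · gcongr
    rw [hWeq, mul_comm]
    gcongr
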